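/- \textbf{Setting.} Let $d\ge 1$, let $\mathcal X\subseteq\mathbb R^d$ be a measurable context space and $\mathcal A$ a finite non-empty set of arms with expected reward functions $\eta_a$, $a\in\mathcal A$; put $\eta^*(x)=\max_a\eta_a(x)$. For $t=1,\dots,T$ a context $X_t$ is drawn, independently of everything that happened before, from a law on $\mathcal X$ with probability density $f$; an arm $A_t$ is pulled, and the reward $Y_t=\eta_{A_t}(X_t)+W_t$ is received. The expected regret is $R=\mathbb E\big[\sum_{t=1}^T(\eta^*(X_t)-\eta_{A_t}(X_t))\big]$. \textbf{Assumptions.} There are constants $0\le\alpha\le d$, $C_\alpha$, $\sigma\ge 0$, $L\ge 0$, $c>0$, $M$, $c_0>0$, $r_0>0$ such that (a) (margin condition) $\mathrm P(0<\eta^*(X)-\eta_a(X)<u)\le C_\alpha u^\alpha$ for all $a\in\mathcal A$ and $u>0$, where $X\sim f$; (b) given $X_1,\dots,X_t,A_1,\dots,A_t,W_1,\dots,W_{t-1}$, the noise $W_t$ has conditional mean zero and is conditionally subgaussian, $\mathbb E[e^{\lambda W_t}\mid X_{1:t},A_{1:t},W_{1:t-1}]\le e^{\lambda^2\sigma^2/2}$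 for all real $\lambda$; (c) $|\eta_a(x)-\eta_a(x')|\le L\|x-x'\|$ for all $a$ and all $x,x'\in\mathcal X$ (Euclidean norm); (d) $f(x)\ge c$ for all $x\in\mathcal X$; (e) $\mathcal X$ is regular: $\mathrm{vol}(\mathcal X\cap B(x,r))\ge c_0\,\mathrm{vol}(B(x,r))$ for all $x\in\mathcal X$ and $0<r\le r_0$; and $\eta^*(x)-\eta_a(x)\le M$ for all $a$ and $x\in\mathcal X$. \textbf{Algorithm} (fixed-$k$ nearest neighbours with UCB exploration). Let $n_a(t)=|\{i<t: A_i=a\}|$. If $n_a(t)<k$ put $\hat\eta_{a,t}(x)=\infty$. Otherwise let $\mathcal N_t(x,a)$ be a set of $k$ nearest neighbours of $x$ among the $X_i$ with $i<t$, $A_i=a$, let $\rho_{a,t}(x)=\max_{i\in\mathcal N_t(x,a)}\|X_i-x\|$, and put $$\hat\eta_{a,t}(x)=\frac1k\sum_{i\in\mathcal N_t(x,a)}Y_i+b+L\rho_{a,t}(x),\qquad b=\sqrt{\frac{2\sigma^2}{k}\ln\big(dT^{2d+2}|\mathcal A|\big)}.$$ The arm pulled at step $t$ is $A_t\in\arg\max_a\hat\eta_{a,t}(X_t)$;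 ties (between distances and between arms) are broken arbitrarily. \textbf{Theorem.} Let $0<\kappa_1\le\kappa_2$. There is a constant $C$ that depends only on $d,\alpha,C_\alpha,\sigma,L,c,c_0,r_0,M,\kappa_1,\kappa_2$ such that, for all $T\ge1$ and all problems as above: (1) if $d>\alpha+1$ and $\kappa_1T^{2/(d+2)}\le k\le\kappa_2T^{2/(d+2)}$, then $$R\le C\,T^{1-\frac{\alpha+1}{d+2}}\,|\mathcal A|\,\ln^{\frac{\alpha+1}{2}}\big(dT^{2d+2}|\mathcal A|\big);$$ (2) if $d\le\alpha+1$ and $\kappa_1T^{2/(\alpha+3)}\le k\le\kappa_2T^{2/(\alpha+3)}$, then $$R\le C\,T^{\frac{2}{\alpha+3}}\,|\mathcal A|\,\ln^{\frac{\alpha+1}{2}}\big(dT^{2d+2}|\mathcal A|\big).$$ -/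

import Mathlib

open MeasureTheory ProbabilityTheory

noncomputable section

namespace KNNBandit

/-- Contexts are vectors of `ℝ^d` with the Euclidean norm. -/
abbrev Ctx (d : ℕ) : Type := EuclideanSpace ℝ (Fin d)

/-- The maximal expected reward `η^*(x) = max_a η_a(x)` (a maximum: there are finitely many arms). -/
def bestReward {d : ℕ} {𝒜 : Type*} (η : 𝒜 → Ctx d → ℝ) (x : Ctx d) : ℝ :=
  ⨆ a, η a x

/-- The suboptimality gap `η^*(x) - η_a(x)`. -/
def gap {d : ℕ} {𝒜 : Type*} (η : 𝒜 → Ctx d → ℝ) (a : 𝒜) (x : Ctx d) : ℝ :=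
  bestReward η x - η a x

/-- The law on `𝒳` with probability density function `f`. -/
def contextLaw {d : ℕ} (𝒳 : Set (Ctx d)) (f : Ctx d → ℝ) : Measure (Ctx d) :=
  (volume.restrict 𝒳).withDensity fun x => ENNReal.ofReal (f x)

/-- `(c₀, r₀)`-regularity of the context space: small balls centred in `𝒳` have at least the
proportion `c₀` of their volume in `𝒳`. -/
structure IsRegularSet {d : ℕ} (c₀ r₀ : ℝ) (𝒳 : Set (Ctx d)) : Prop where
  measurableSet : MeasurableSet 𝒳
  volume_le : ∀ x ∈ 𝒳, ∀ r : ℝ, 0 < r → r ≤ r₀ →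
    ENNReal.ofReal c₀ * volume (Metric.closedBall x r) ≤ volume (𝒳 ∩ Metric.closedBall x r)

/-- The Tsybakov margin condition with exponent `α` and constant `Cα`. -/
def MarginCondition {d : ℕ} {𝒜 : Type*} (α Cα : ℝ) (ν : Measure (Ctx d))
    (η : 𝒜 → Ctx d → ℝ) : Prop :=
  ∀ (a : 𝒜) (u : ℝ), 0 < u → ν {x | 0 < gap η a x ∧ gap η a x < u} ≤ ENNReal.ofReal (Cα * u ^ α)

/-- A context space, a context density and expected rewards: `𝒳` is regular, the density is at
least `c` on `𝒳`, the expected rewards are `L`-Lipschitz on `𝒳`, satisfy the margin condition, and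
have gaps at most `M`. -/
structure IsBanditProblem {d : ℕ} {𝒜 : Type*} (α Cα L c c₀ r₀ M : ℝ) (𝒳 : Set (Ctx d))
    (f : Ctx d → ℝ) (η : 𝒜 → Ctx d → ℝ) : Prop where
  regular : IsRegularSet c₀ r₀ 𝒳
  measurable_density : Measurable f
  density_ge : ∀ x ∈ 𝒳, c ≤ f x
  lipschitz : ∀ a, ∀ x ∈ 𝒳, ∀ x' ∈ 𝒳, |η a x - η a x'| ≤ L * ‖x - x'‖
  margin : MarginCondition α Cα (contextLaw 𝒳 f) η
  gap_le : ∀ a, ∀ x ∈ 𝒳, gap η a x ≤ M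

section Algorithm

variable {d : ℕ} {𝒜 : Type*} [DecidableEq 𝒜]

/-- The steps before step `t` at which arm `a` was pulled (steps are numbered `0, …, T - 1`). -/
def pulls (A : ℕ → 𝒜) (t : ℕ) (a : 𝒜) : Finset ℕ :=
  (Finset.range t).filter fun i => A i = a

/-- `N` consists of `k` nearest neighbours of `x` among the steps in `S`
(ties in the distance may be broken in any way). -/
structure IsKNearest (X : ℕ → Ctx d) (k : ℕ) (x : Ctx d) (S N : Finset ℕ) : Prop where
  subset : N ⊆ S
  card_eq : N.card = k
  nearest : ∀ i ∈ N, ∀ j ∈ S, j ∉ N → ‖X i - x‖ ≤ ‖X j - x‖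

/-- The nearest neighbour distance `max_{i ∈ N} ‖X_i - x‖`. -/
def knnRadius (X : ℕ → Ctx d) (x : Ctx d) (N : Finset ℕ) : ℝ :=
  ⨆ i : N, ‖X i - x‖

/-- The number `d T^(2d+2) |𝒜|`, here with `m = |𝒜|`. -/
def logArg (d T m : ℕ) : ℝ :=
  (d : ℝ) * (T : ℝ) ^ (2 * d + 2) * (m : ℝ)

/-- `b = sqrt ((2 σ² / k) ln (d T^(2d+2) |𝒜|))`. -/
def bonus (d T m k : ℕ) (σ : ℝ) : ℝ :=
  Real.sqrt (2 * σ ^ 2 / (k : ℝ) * Real.log (logArg d T m))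

/-- The upper confidence bound of arm `a` at step `t` and context `x`, where `N` is the set of the
`k` nearest neighbours of `x` among the earlier pulls of arm `a`; it is infinite as long as
arm `a` has been pulled fewer than `k` times. -/
def ucb (σ L : ℝ) (T m k : ℕ) (X : ℕ → Ctx d) (Y : ℕ → ℝ) (A : ℕ → 𝒜) (t : ℕ) (a : 𝒜)
    (x : Ctx d) (N : Finset ℕ) : EReal :=
  if k ≤ (pulls A t a).card then
    (((1 / (k : ℝ)) * ∑ i ∈ N, Y i + bonus d T m k σ + L * knnRadius X x N : ℝ) : EReal)
  else ⊤

/-- Along one trajectory, the arm pulled at step `t` maximizes the upper confidence bound at the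
current context (ties between arms may be broken in any way). -/
def SelectsUCB [Fintype 𝒜] (σ L : ℝ) (T k : ℕ) (X : ℕ → Ctx d) (Y : ℕ → ℝ) (A : ℕ → 𝒜)
    (t : ℕ) : Prop :=
  ∃ N : 𝒜 → Finset ℕ,
    (∀ a, k ≤ (pulls A t a).card → IsKNearest X k (X t) (pulls A t a) (N a)) ∧
    ∀ a, ucb σ L T (Fintype.card 𝒜) k X Y A t a (X t) (N a) ≤
      ucb σ L T (Fintype.card 𝒜) k X Y A t (A t) (X t) (N (A t))

end Algorithm

section Interaction

variable {d : ℕ} {𝒜 : Type*} {Ω : Type*} [MeasurableSpace 𝒜]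

/-- The rewards `Y_t = η_{A_t}(X_t) + W_t`. -/
def reward (η : 𝒜 → Ctx d → ℝ) (X : ℕ → Ω → Ctx d) (W : ℕ → Ω → ℝ) (A : ℕ → Ω → 𝒜)
    (t : ℕ) (ω : Ω) : ℝ :=
  η (A t ω) (X t ω) + W t ω

/-- The σ-algebra of the contexts, arms and noise variables of the steps before `t`. -/
@[reducible]
def pastSigma (X : ℕ → Ω → Ctx d) (W : ℕ → Ω → ℝ) (A : ℕ → Ω → 𝒜) (t : ℕ) :
    MeasurableSpace Ω :=
  ⨆ i : ℕ, ⨆ _ : i < t,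
    (MeasurableSpace.comap (X i) inferInstance ⊔ MeasurableSpace.comap (A i) inferInstance ⊔
      MeasurableSpace.comap (W i) inferInstance)

/-- The σ-algebra of everything that precedes the noise of step `t`: the past, the context `X_t`
and the arm `A_t`. -/
@[reducible]
def infoSigma (X : ℕ → Ω → Ctx d) (W : ℕ → Ω → ℝ) (A : ℕ → Ω → 𝒜) (t : ℕ) :
    MeasurableSpace Ω :=
  pastSigma X W A t ⊔ MeasurableSpace.comap (X t) inferInstance ⊔
    MeasurableSpace.comap (A t) inferInstance

/-- `T` rounds of interaction: the contexts are drawn independently of the past from the law `ν`,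
the noise `W_t` has conditional mean zero and is conditionally `σ²`-subgaussian given all that
precedes it, and the arms are random variables. -/
structure IsInteraction [MeasurableSpace Ω] (P : Measure Ω) (ν : Measure (Ctx d)) (σ : ℝ)
    (T : ℕ) (X : ℕ → Ω → Ctx d) (W : ℕ → Ω → ℝ) (A : ℕ → Ω → 𝒜) : Prop where
  measurable_context : ∀ t < T, Measurable (X t)
  measurable_noise : ∀ t < T, Measurable (W t)
  measurable_arm : ∀ t < T, Measurable (A t)
  context_law : ∀ t < T, P.map (X t) = ν
  context_indep : ∀ t < T,
    Indep (MeasurableSpace.comap (X t) inferInstance) (pastSigma X W A t) P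
  noise_integrable : ∀ t < T, Integrable (W t) P
  noise_mean : ∀ t < T, P[W t | infoSigma X W A t] =ᵐ[P] 0
  noise_exp_integrable : ∀ t < T, ∀ l : ℝ, Integrable (fun ω => Real.exp (l * W t ω)) P
  noise_subgaussian : ∀ t < T, ∀ l : ℝ,
    P[fun ω => Real.exp (l * W t ω) | infoSigma X W A t]
      ≤ᵐ[P] fun _ => Real.exp (l ^ 2 * σ ^ 2 / 2)

/-- The arms are those of the fixed-`k` nearest neighbour method with UCB exploration. -/
def FollowsKNNUCB [MeasurableSpace Ω] [Fintype 𝒜] [DecidableEq 𝒜] (P : Measure Ω)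
    (η : 𝒜 → Ctx d → ℝ) (σ L : ℝ) (T k : ℕ) (X : ℕ → Ω → Ctx d) (W : ℕ → Ω → ℝ)
    (A : ℕ → Ω → 𝒜) : Prop :=
  ∀ t < T, ∀ᵐ ω ∂P,
    SelectsUCB σ L T k (fun i => X i ω) (fun i => reward η X W A i ω) (fun i => A i ω) t

/-- The regret `∑_t (η^*(X_t) - η_{A_t}(X_t))` of a trajectory. -/
def pathRegret (η : 𝒜 → Ctx d → ℝ) (T : ℕ) (X : ℕ → Ω → Ctx d) (A : ℕ → Ω → 𝒜) (ω : Ω) : ℝ :=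
  ∑ t ∈ Finset.range T, gap η (A t ω) (X t ω)

end Interaction

/-- The claim "with `k ~ T^p`, the expected regret of the fixed-`k` method is
`≲ T^q |𝒜| ln^((α+1)/2) (d T^(2d+2) |𝒜|)`". The constant `C` depends only on the displayed
arguments and on the constants `κ₁, κ₂` hidden in `k ~ T^p`: it is the same for all context spaces,
densities, sets of arms, expected rewards, noise distributions, horizons `T` and admissible `k`. -/
def RegretBound.{u, v} (d : ℕ) (α Cα σ L c c₀ r₀ M p q : ℝ) : Prop :=
  ∀ κ₁ κ₂ : ℝ, 0 < κ₁ → ∃ C : ℝ, 0 < C ∧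
    ∀ (𝒜 : Type u) [Fintype 𝒜] [Nonempty 𝒜] [DecidableEq 𝒜] [MeasurableSpace 𝒜]
      [MeasurableSingletonClass 𝒜]
      (Ω : Type v) [MeasurableSpace Ω] (P : Measure Ω) [IsProbabilityMeasure P]
      (𝒳 : Set (Ctx d)) (f : Ctx d → ℝ) (η : 𝒜 → Ctx d → ℝ)
      (X : ℕ → Ω → Ctx d) (W : ℕ → Ω → ℝ) (A : ℕ → Ω → 𝒜) (T k : ℕ),
      1 ≤ T →
      κ₁ * (T : ℝ) ^ p ≤ k → (k : ℝ) ≤ κ₂ * (T : ℝ) ^ p →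
      IsBanditProblem α Cα L c c₀ r₀ M 𝒳 f η →
      IsInteraction P (contextLaw 𝒳 f) σ T X W A →
      FollowsKNNUCB P η σ L T k X W A →
      Integrable (pathRegret η T X A) P ∧
      ∫ ω, pathRegret η T X A ω ∂P ≤
        C * (T : ℝ) ^ q * (Fintype.card 𝒜 : ℝ) *
          Real.log (logArg d T (Fintype.card 𝒜)) ^ ((α + 1) / 2)

end KNNBandit

end

/-! The regret is a sum of gaps of pulled arms, charged to four sources: a rare event of bad noise,
the first `k` pulls of each arm, small gaps and large gaps.

Noise. Ties in distance have probability zero, so the `k` nearest neighbours of `X_t` among the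
pulls of `a` are the pulls in the ball around `X_t` through one of them, `X_j`. For fixed `t`, `a`,
`j`, membership of step `i` is decided by `A_i` and the contexts up to `t`. Contexts after `i` are
independent of everything up to and including `W_i`, so `W_i` stays conditionally subgaussian when
they are revealed in advance, and an exponential supermartingale controls the noise sum
(`IsInteraction.lintegral_prod_tiltFactor_le_one`). A union over at most `T² |𝒜|` triples leaves a
bad event of probability at most `2 / T` (`IsInteraction.exists_deviation_event`).

Geometry. Off this event an arm pulled at least `k` times before has gap at most `2b + 2Lρ`. Hence a
gap `g ≥ 4b` forces `ρ ≥ g / (4(L+1))`: fewer than `k` earlier pulls of the arm lie near `X_t`.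
Balls of radius `κ g` around such contexts therefore cover any point of `𝒳` at most `k` times, and
the gap is constant on each up to a factor 2. Such a ball has mass at least a constant times `g^d`,
so these gaps add up to at most a constant times `k ∫ gap^(-(d-1))` over `gap ≥ u/2`
(`IsBanditProblem.sum_gap_le`).

Margin. Dyadic shells turn that integral into a geometric sum of ratio `2^(d-1-α)`
(`IsBanditProblem.lintegral_gapWeight_le`).

Balance. With `k ~ T^p` and `u ~ l^(1/2) T^(-p/2)`, `l` being the logarithm, gaps below `u` cost `T
|𝒜| u^(α+1)`, which is `T^(1-p(α+1)/2) l^((α+1)/2)` per arm. For `d > α+1` the large gaps cost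
`T^(p+p(d-1-α)/2)` per arm, and `p = 2/(d+2)` equates the exponents. For `d ≤ α+1` the first `k`
pulls are the competitor, whence `p = 2/(α+3)`. -/

namespace KNNBandit

/-! ### Independence and conditional bounds for joins of σ-algebras -/

section SigmaAlgebras

variable {Ω : Type*}

/-- The intersections of sets of two σ-algebras. -/
def interRects (m₁ m₂ : MeasurableSpace Ω) : Set (Set Ω) :=
  {s | ∃ A B, MeasurableSet[m₁] A ∧ MeasurableSet[m₂] B ∧ s = A ∩ B}

lemma isPiSystem_interRects (m₁ m₂ : MeasurableSpace Ω) : IsPiSystem (interRects m₁ m₂) := by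
  rintro _ ⟨A, B, hA, hB, rfl⟩ _ ⟨A', B', hA', hB', rfl⟩ -
  exact ⟨A ∩ A', B ∩ B', hA.inter hA', hB.inter hB', by ext; simp; tauto⟩

lemma generateFrom_interRects (m₁ m₂ : MeasurableSpace Ω) :
    m₁ ⊔ m₂ = MeasurableSpace.generateFrom (interRects m₁ m₂) := by
  apply le_antisymm
  · refine sup_le (fun s hs => ?_) (fun s hs => ?_)
    · exact MeasurableSpace.measurableSet_generateFrom ⟨s, Set.univ, hs, .univ, by simp⟩
    · exact MeasurableSpace.measurableSet_generateFrom ⟨Set.univ, s, .univ, hs, by simp⟩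
  · refine MeasurableSpace.generateFrom_le ?_
    rintro _ ⟨A, B, hA, hB, rfl⟩
    exact MeasurableSet.inter (le_sup_left (a := m₁) (b := m₂) _ hA)
      (le_sup_right (a := m₁) (b := m₂) _ hB)

/-- Chain rule for independence: on the π-system of intersections `B ∩ C` the probability factors by
splitting off `C` first, then `B`. It allows future contexts to be adjoined one at a time. -/
lemma indep_sup_right {m h₁ h₂ : MeasurableSpace Ω} [mΩ : MeasurableSpace Ω] {P : Measure Ω}
    [IsProbabilityMeasure P] (hm : m ≤ mΩ) (hh₁ : h₁ ≤ mΩ) (hh₂ : h₂ ≤ mΩ)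
    (i₁ : Indep m h₁ P) (i₂ : Indep (m ⊔ h₁) h₂ P) : Indep m (h₁ ⊔ h₂) P := by
  refine IndepSets.indep hm (sup_le hh₁ hh₂) (@MeasurableSpace.isPiSystem_measurableSet Ω m)
    (isPiSystem_interRects h₁ h₂) (@MeasurableSpace.generateFrom_measurableSet Ω m).symm
    (generateFrom_interRects h₁ h₂) ?_
  rw [IndepSets_iff]
  rintro A _ hA ⟨B, C, hB, hC, rfl⟩
  rw [Indep_iff] at i₁ i₂
  have hA' : MeasurableSet[m ⊔ h₁] A := le_sup_left (a := m) (b := h₁) _ hA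
  have hB' : MeasurableSet[m ⊔ h₁] B := le_sup_right (a := m) (b := h₁) _ hB
  rw [← Set.inter_assoc, i₂ _ _ (hA'.inter hB') hC, i₂ _ _ hB' hC, i₁ _ _ hA hB, mul_assoc]

/-- The measures with densities `F` and `G` agree on a π-system generating `m₁ ⊔ m₂`, so their
restrictions to that σ-algebra coincide. -/
lemma lintegral_mul_eq_of_interRects {m₁ m₂ : MeasurableSpace Ω} [mΩ : MeasurableSpace Ω]
    {P : Measure Ω} (h₁ : m₁ ≤ mΩ) (h₂ : m₂ ≤ mΩ) {F G φ : Ω → ENNReal}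
    (hF : Measurable F) (hG : Measurable G) (hFt : ∫⁻ ω, F ω ∂P ≠ ⊤)
    (h : ∀ A B, MeasurableSet[m₁] A → MeasurableSet[m₂] B →
      ∫⁻ ω in A ∩ B, F ω ∂P = ∫⁻ ω in A ∩ B, G ω ∂P)
    (hφ : Measurable[m₁ ⊔ m₂] φ) :
    ∫⁻ ω, φ ω * F ω ∂P = ∫⁻ ω, φ ω * G ω ∂P := by
  have h12 : m₁ ⊔ m₂ ≤ mΩ := sup_le h₁ h₂
  have hφ' : Measurable φ := hφ.mono h12 le_rfl
  have key : (P.withDensity F).trim h12 = (P.withDensity G).trim h12 := by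
    have : IsFiniteMeasure (P.withDensity F) := isFiniteMeasure_withDensity hFt
    have : IsFiniteMeasure ((P.withDensity F).trim h12) := isFiniteMeasure_trim h12
    refine @ext_of_generate_finite Ω (m₁ ⊔ m₂) _ _ (interRects m₁ m₂)
      (generateFrom_interRects m₁ m₂) (isPiSystem_interRects m₁ m₂) this ?_ ?_
    · rintro s ⟨A, B, hA, hB, rfl⟩
      have hs : MeasurableSet[m₁ ⊔ m₂] (A ∩ B) := by
        rw [generateFrom_interRects]
        exact MeasurableSpace.measurableSet_generateFrom ⟨A, B, hA, hB, rfl⟩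
      rw [trim_measurableSet_eq _ hs, trim_measurableSet_eq _ hs, withDensity_apply _ (h12 _ hs),
        withDensity_apply _ (h12 _ hs), h A B hA hB]
    · rw [trim_measurableSet_eq _ .univ, trim_measurableSet_eq _ .univ,
        withDensity_apply _ .univ, withDensity_apply _ .univ]
      simpa using h Set.univ Set.univ .univ .univ
  have e : ∀ K : Ω → ENNReal, Measurable K →
      ∫⁻ ω, φ ω * K ω ∂P = ∫⁻ ω, φ ω ∂((P.withDensity K).trim h12) := by
    intro K hK
    rw [lintegral_trim h12 hφ, lintegral_withDensity_eq_lintegral_mul _ hK hφ']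
    exact lintegral_congr fun ω => mul_comm _ _
  rw [e F hF, e G hG, key]

/-- A conditional bound given `m` is preserved when `m` is enlarged by a σ-algebra which is
independent of `m` and the integrand. -/
lemma lintegral_mul_le_of_condExp_le {m m' h : MeasurableSpace Ω} [mΩ : MeasurableSpace Ω]
    {P : Measure Ω} [IsProbabilityMeasure P] (hmm' : m ≤ m') (hm' : m' ≤ mΩ)
    (hh : h ≤ mΩ) (hind : Indep m' h P) {F : Ω → ℝ} (hF : Measurable[m'] F) (hF0 : 0 ≤ F)
    (hFi : Integrable F P) {c : ℝ} (hc : P[F | m] ≤ᵐ[P] fun _ => c)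
    {φ : Ω → ENNReal} (hφ : Measurable[m ⊔ h] φ) :
    ∫⁻ ω, φ ω * ENNReal.ofReal (F ω) ∂P ≤ ENNReal.ofReal c * ∫⁻ ω, φ ω ∂P := by
  have hm : m ≤ mΩ := hmm'.trans hm'
  have hφ' : Measurable φ := hφ.mono (sup_le hm hh) le_rfl
  set G : Ω → ℝ := P[F | m] with hG
  have hGm : Measurable[m] G := stronglyMeasurable_condExp.measurable
  have hG0 : 0 ≤ᵐ[P] G := condExp_nonneg (Filter.Eventually.of_forall hF0)
  -- On `A ∩ B` the independent factor `P B` splits off, both for `F` and for its conditional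
  -- expectation `G`; what remains over `A` is equal for the two by definition of `G`.
  have hsplit : ∀ K : Ω → ℝ, Measurable[m'] K → ∀ A B, MeasurableSet[m] A → MeasurableSet[h] B →
      ∫⁻ ω in A ∩ B, ENNReal.ofReal (K ω) ∂P
        = (∫⁻ ω in A, ENNReal.ofReal (K ω) ∂P) * P B := by
    intro K hK A B hA hB
    have hB1 : Measurable[h] (B.indicator (1 : Ω → ENNReal)) := by
      exact Measurable.indicator (@measurable_const ENNReal Ω _ h 1) hB
    have := lintegral_mul_eq_lintegral_mul_lintegral_of_independent_measurableSpace hm' hh hind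
      (f := A.indicator fun ω => ENNReal.ofReal (K ω)) (g := B.indicator 1)
      ((hK.ennreal_ofReal).indicator (hmm' _ hA)) hB1
    rw [lintegral_indicator (hm _ hA), lintegral_indicator_one (hh _ hB)] at this
    rw [← this, ← lintegral_indicator ((hm _ hA).inter (hh _ hB))]
    refine lintegral_congr fun ω => ?_
    by_cases h1 : ω ∈ A <;> by_cases h2 : ω ∈ B <;> simp [h1, h2]
  have heq : ∫⁻ ω, φ ω * ENNReal.ofReal (F ω) ∂P = ∫⁻ ω, φ ω * ENNReal.ofReal (G ω) ∂P := by
    refine lintegral_mul_eq_of_interRects hm hh (hF.mono hm' le_rfl).ennreal_ofReal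
      (hGm.mono hm le_rfl).ennreal_ofReal ?_ ?_ hφ
    · rw [← ofReal_integral_eq_lintegral_ofReal hFi (Filter.Eventually.of_forall hF0)]
      exact ENNReal.ofReal_ne_top
    · intro A B hA hB
      rw [hsplit F hF A B hA hB, hsplit G (hGm.mono hmm' le_rfl) A B hA hB,
        ← ofReal_integral_eq_lintegral_ofReal hFi.integrableOn
          (Filter.Eventually.of_forall hF0),
        ← ofReal_integral_eq_lintegral_ofReal integrable_condExp.integrableOn
          (ae_restrict_of_ae hG0), setIntegral_condExp hm hFi hA]
  rw [heq, mul_comm, ← lintegral_mul_const _ hφ']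
  refine lintegral_mono_ae ?_
  filter_upwards [hc] with ω hω
  gcongr

end SigmaAlgebras

/-! ### The exponential supermartingale with future contexts revealed -/

section Concentration

variable {d : ℕ} {𝒜 : Type*} {Ω : Type*} [MeasurableSpace 𝒜]

/-- The σ-algebra of the contexts of the steps after `m` up to `n`. -/
@[reducible]
def futureSigma (X : ℕ → Ω → Ctx d) (m n : ℕ) : MeasurableSpace Ω :=
  ⨆ i : ℕ, ⨆ _ : m < i ∧ i ≤ n, MeasurableSpace.comap (X i) inferInstance

section Inclusions

variable (X : ℕ → Ω → Ctx d) (W : ℕ → Ω → ℝ) (A : ℕ → Ω → 𝒜)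

lemma comap_context_le_pastSigma {i t : ℕ} (h : i < t) :
    MeasurableSpace.comap (X i) inferInstance ≤ pastSigma X W A t :=
  (le_sup_left.trans le_sup_left).trans (le_iSup₂_of_le i h le_rfl)

lemma comap_arm_le_pastSigma {i t : ℕ} (h : i < t) :
    MeasurableSpace.comap (A i) inferInstance ≤ pastSigma X W A t :=
  (le_sup_right.trans le_sup_left).trans (le_iSup₂_of_le i h le_rfl)

lemma comap_noise_le_pastSigma {i t : ℕ} (h : i < t) :
    MeasurableSpace.comap (W i) inferInstance ≤ pastSigma X W A t :=
  le_sup_right.trans (le_iSup₂_of_le i h le_rfl)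

lemma pastSigma_mono {s t : ℕ} (h : s ≤ t) : pastSigma X W A s ≤ pastSigma X W A t :=
  iSup₂_le fun i hi => le_iSup₂_of_le i (hi.trans_le h) le_rfl

lemma infoSigma_le_pastSigma {s t : ℕ} (h : s < t) :
    infoSigma X W A s ≤ pastSigma X W A t :=
  sup_le (sup_le (pastSigma_mono X W A h.le) (comap_context_le_pastSigma X W A h))
    (comap_arm_le_pastSigma X W A h)

lemma futureSigma_le_pastSigma {m n t : ℕ} (h : n < t) :
    futureSigma X m n ≤ pastSigma X W A t :=
  iSup₂_le fun _ hi => comap_context_le_pastSigma X W A (hi.2.trans_lt h)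

lemma comap_context_le_info_sup_future {i j t : ℕ} (h : j ≤ t) :
    MeasurableSpace.comap (X j) inferInstance ≤ infoSigma X W A i ⊔ futureSigma X i t := by
  rcases lt_trichotomy j i with hji | rfl | hij
  · exact (comap_context_le_pastSigma X W A hji).trans
      ((le_sup_left.trans le_sup_left).trans le_sup_left)
  · exact (le_sup_right.trans le_sup_left).trans le_sup_left
  · exact le_sup_of_le_right (le_iSup₂_of_le (f := fun i' (_ : i < i' ∧ i' ≤ t) =>
      MeasurableSpace.comap (X i') inferInstance) j ⟨hij, h⟩ le_rfl)

/-- Even with all contexts up to `t` revealed, the σ-algebras form a filtration, so earlier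
selections and noise are known when the noise of step `m` arrives. -/
lemma info_sup_future_mono {i m t : ℕ} (h : i ≤ m) :
    infoSigma X W A i ⊔ futureSigma X i t ≤ infoSigma X W A m ⊔ futureSigma X m t := by
  rcases h.eq_or_lt with rfl | h
  · exact le_rfl
  refine sup_le ?_ (iSup₂_le fun j hj => comap_context_le_info_sup_future X W A hj.2)
  exact (infoSigma_le_pastSigma X W A h).trans ((le_sup_left.trans le_sup_left).trans le_sup_left)

end Inclusions

/-- The factor `exp (l W - l² σ² / 2)` on `D`, and `1` off `D`. -/
noncomputable def tiltFactor (σ l : ℝ) (D : Set Ω) (w : Ω → ℝ) (ω : Ω) : ENNReal :=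
  D.indicator (fun ω => ENNReal.ofReal (Real.exp (l * w ω - l ^ 2 * σ ^ 2 / 2))) ω +
    Dᶜ.indicator 1 ω

lemma measurable_tiltFactor {m : MeasurableSpace Ω} (σ l : ℝ) {D : Set Ω} {w : Ω → ℝ}
    (hD : MeasurableSet[m] D) (hw : Measurable[m] w) : Measurable[m] (tiltFactor σ l D w) := by
  refine Measurable.add (Measurable.indicator ?_ hD)
    (Measurable.indicator (@measurable_const ENNReal Ω _ m 1) hD.compl)
  exact (Real.measurable_exp.comp ((hw.const_mul l).sub_const _)).ennreal_ofReal

open Classical in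
/-- The steps before `t` whose event in `D` occurs. -/
noncomputable def occurring (D : ℕ → Set Ω) (t : ℕ) (ω : Ω) : Finset ℕ :=
  (Finset.range t).filter fun i => ω ∈ D i

lemma mem_occurring {D : ℕ → Set Ω} {t : ℕ} {ω : Ω} {i : ℕ} :
    i ∈ occurring D t ω ↔ i < t ∧ ω ∈ D i := by
  classical
  rw [occurring, Finset.mem_filter, Finset.mem_range]

lemma prod_tiltFactor_eq {W : ℕ → Ω → ℝ} (σ l : ℝ) (D : ℕ → Set Ω) (t : ℕ) (ω : Ω) :
    ∏ i ∈ Finset.range t, tiltFactor σ l (D i) (W i) ω = ENNReal.ofReal (Real.exp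
      (l * ∑ i ∈ occurring D t ω, W i ω - (occurring D t ω).card * (l ^ 2 * σ ^ 2 / 2))) := by
  classical
  have h : ∀ i, tiltFactor σ l (D i) (W i) ω =
      if ω ∈ D i then ENNReal.ofReal (Real.exp (l * W i ω - l ^ 2 * σ ^ 2 / 2)) else 1 := by
    intro i
    by_cases hi : ω ∈ D i <;> simp [tiltFactor, hi]
  simp_rw [h]
  rw [← Finset.prod_filter, ← ENNReal.ofReal_prod_of_nonneg fun _ _ => (Real.exp_pos _).le,
    ← Real.exp_sum, Finset.sum_sub_distrib, ← Finset.mul_sum, Finset.sum_const, nsmul_eq_mul]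
  rfl

variable [mΩ : MeasurableSpace Ω] {P : Measure Ω} {ν : Measure (Ctx d)} {σ : ℝ} {T : ℕ}
  {X : ℕ → Ω → Ctx d} {W : ℕ → Ω → ℝ} {A : ℕ → Ω → 𝒜}

lemma IsInteraction.pastSigma_le (hI : IsInteraction P ν σ T X W A) {t : ℕ} (ht : t ≤ T) :
    pastSigma X W A t ≤ mΩ :=
  iSup₂_le fun i hi => sup_le (sup_le (hI.measurable_context i (hi.trans_le ht)).comap_le
    (hI.measurable_arm i (hi.trans_le ht)).comap_le)
    (hI.measurable_noise i (hi.trans_le ht)).comap_le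

lemma IsInteraction.futureSigma_le (hI : IsInteraction P ν σ T X W A) {m n : ℕ} (hn : n < T) :
    futureSigma X m n ≤ mΩ :=
  iSup₂_le fun i hi => (hI.measurable_context i (hi.2.trans_lt hn)).comap_le

lemma IsInteraction.indep_futureSigma [IsProbabilityMeasure P] (hI : IsInteraction P ν σ T X W A)
    {m n : ℕ} (hmn : m ≤ n) (hn : n < T) :
    Indep (pastSigma X W A (m + 1)) (futureSigma X m n) P := by
  induction n, hmn using Nat.le_induction with
  | base =>
    have : futureSigma X m m = ⊥ := by
      refine le_bot_iff.1 (iSup₂_le fun i hi => ?_)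
      omega
    rw [this]
    exact indep_bot_right _
  | succ n hmn ih =>
    have hsup : futureSigma X m (n + 1) ≤
        futureSigma X m n ⊔ MeasurableSpace.comap (X (n + 1)) inferInstance := by
      refine iSup₂_le fun i hi => ?_
      rcases hi.2.eq_or_lt with rfl | h
      · exact le_sup_right
      · exact le_sup_of_le_left (le_iSup₂_of_le (f := fun i' (_ : m < i' ∧ i' ≤ n) =>
          MeasurableSpace.comap (X i') inferInstance) i ⟨hi.1, by omega⟩ le_rfl)
    refine indep_of_indep_of_le_right (indep_sup_right (hI.pastSigma_le (by omega))
      (hI.futureSigma_le (by omega)) (hI.measurable_context _ hn).comap_le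
      (ih (by omega)) ?_) hsup
    exact indep_of_indep_of_le_left (hI.context_indep _ hn).symm
      (sup_le (pastSigma_mono X W A (by omega)) (futureSigma_le_pastSigma X W A (by omega)))

/-- The supermartingale behind the concentration bound: the noise remains conditionally subgaussian
when the future contexts are known. -/
lemma IsInteraction.lintegral_prod_tiltFactor_le_one [IsProbabilityMeasure P]
    (hI : IsInteraction P ν σ T X W A) {t : ℕ} (ht : t < T) (D : ℕ → Set Ω)
    (hD : ∀ i < t, MeasurableSet[infoSigma X W A i ⊔ futureSigma X i t] (D i)) (l : ℝ)
    {m : ℕ} (hm : m ≤ t) :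
    ∫⁻ ω, ∏ i ∈ Finset.range m, tiltFactor σ l (D i) (W i) ω ∂P ≤ 1 := by
  induction m with
  | zero => simp
  | succ m ih =>
    have hmt : m < t := hm
    have hSle : infoSigma X W A m ⊔ futureSigma X m t ≤ mΩ := sup_le ((infoSigma_le_pastSigma X W A hmt).trans
      (hI.pastSigma_le ht.le)) (hI.futureSigma_le ht)
    set Φ : Ω → ENNReal := fun ω => ∏ i ∈ Finset.range m, tiltFactor σ l (D i) (W i) ω with hΦ
    have hΦm : Measurable[infoSigma X W A m ⊔ futureSigma X m t] Φ := by
      refine Finset.measurable_fun_prod _ fun i hi => ?_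
      have him : i < m := Finset.mem_range.1 hi
      have hle : MeasurableSpace.comap (W i) inferInstance ≤
          infoSigma X W A m ⊔ futureSigma X m t :=
        (comap_noise_le_pastSigma X W A him).trans
          ((le_sup_left.trans le_sup_left).trans le_sup_left)
      exact measurable_tiltFactor σ l (info_sup_future_mono X W A him.le _ (hD i (by omega)))
        ((comap_measurable (W i)).mono hle le_rfl)
    have hDm := hD m hmt
    set e : ℝ := l ^ 2 * σ ^ 2 / 2 with he
    -- The weight carries `exp (-e)` on `D m`, which cancels the conditional bound `exp e`; off `D
    -- m` the new factor is 1.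
    have hφ : Measurable[infoSigma X W A m ⊔ futureSigma X m t]
        ((D m).indicator fun ω => Φ ω * ENNReal.ofReal (Real.exp (-e))) :=
      Measurable.indicator (hΦm.mul_const _) hDm
    have hstep := lintegral_mul_le_of_condExp_le (P := P)
      (infoSigma_le_pastSigma X W A (lt_add_one m))
      (hI.pastSigma_le (by omega)) (hI.futureSigma_le ht) (hI.indep_futureSigma hmt.le ht)
      (F := fun ω => Real.exp (l * W m ω))
      (Real.measurable_exp.comp (((comap_measurable (W m)).mono
        (comap_noise_le_pastSigma X W A (lt_add_one m)) le_rfl).const_mul l))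
      (fun ω => (Real.exp_pos _).le) (hI.noise_exp_integrable m (by omega) l)
      (hI.noise_subgaussian m (by omega) l) hφ
    have hΦ' : Measurable Φ := hΦm.mono hSle le_rfl
    calc ∫⁻ ω, ∏ i ∈ Finset.range (m + 1), tiltFactor σ l (D i) (W i) ω ∂P
        = ∫⁻ ω, (D m)ᶜ.indicator Φ ω + (D m).indicator
            (fun ω => Φ ω * ENNReal.ofReal (Real.exp (-e))) ω *
              ENNReal.ofReal (Real.exp (l * W m ω)) ∂P := by
          refine lintegral_congr fun ω => ?_
          rw [Finset.prod_range_succ]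
          change Φ ω * _ = _
          by_cases hω : ω ∈ D m
          · simp only [tiltFactor, hω, Set.indicator_of_mem, Set.mem_compl_iff, not_true_eq_false,
              not_false_eq_true, Set.indicator_of_notMem, add_zero, zero_add]
            rw [mul_assoc, ← ENNReal.ofReal_mul (Real.exp_pos _).le, ← Real.exp_add]
            congr 3
            ring
          · simp [tiltFactor, hω]
      _ = ∫⁻ ω, (D m)ᶜ.indicator Φ ω ∂P + ∫⁻ ω, (D m).indicator
            (fun ω => Φ ω * ENNReal.ofReal (Real.exp (-e))) ω *
              ENNReal.ofReal (Real.exp (l * W m ω)) ∂P :=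
          lintegral_add_left (hΦ'.indicator (hSle _ hDm).compl) _
      _ ≤ ∫⁻ ω, (D m)ᶜ.indicator Φ ω ∂P + ENNReal.ofReal (Real.exp e) * ∫⁻ ω, (D m).indicator
            (fun ω => Φ ω * ENNReal.ofReal (Real.exp (-e))) ω ∂P := by gcongr
      _ = ∫⁻ ω, (D m)ᶜ.indicator Φ ω ∂P + ∫⁻ ω, (D m).indicator Φ ω ∂P := by
          congr 1
          rw [← lintegral_const_mul _ (hφ.mono hSle le_rfl)]
          refine lintegral_congr fun ω => ?_
          by_cases hω : ω ∈ D m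
          · simp only [hω, Set.indicator_of_mem]
            rw [mul_left_comm, ← ENNReal.ofReal_mul (Real.exp_pos _).le, ← Real.exp_add]
            simp
          · simp [hω]
      _ = ∫⁻ ω, Φ ω ∂P := by
          rw [← lintegral_add_left (hΦ'.indicator (hSle _ hDm).compl)]
          refine lintegral_congr fun ω => ?_
          by_cases hω : ω ∈ D m <;> simp [hω]
      _ ≤ 1 := ih hmt.le

/-- Markov's inequality for the tilted product: fixing the number of selected steps to be `k` makes
the compensating term deterministic. -/
lemma IsInteraction.measure_chernoff [IsProbabilityMeasure P]
    (hI : IsInteraction P ν σ T X W A) {t : ℕ} (ht : t < T) (D : ℕ → Set Ω)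
    (hD : ∀ i < t, MeasurableSet[infoSigma X W A i ⊔ futureSigma X i t] (D i)) (l r : ℝ) (k : ℕ) :
    P {ω | (occurring D t ω).card = k ∧ r ≤ l * ∑ i ∈ occurring D t ω, W i ω} ≤
      ENNReal.ofReal (Real.exp (k * (l ^ 2 * σ ^ 2 / 2) - r)) := by
  have hDm : ∀ i < t, MeasurableSet (D i) := fun i hi =>
    (sup_le ((infoSigma_le_pastSigma X W A hi).trans (hI.pastSigma_le ht.le))
      (hI.futureSigma_le ht)) _ (hD i hi)
  have hmeas : Measurable fun ω => ∏ i ∈ Finset.range t, tiltFactor σ l (D i) (W i) ω :=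
    Finset.measurable_fun_prod _ fun i hi => measurable_tiltFactor σ l
      (hDm i (Finset.mem_range.1 hi)) (hI.measurable_noise i ((Finset.mem_range.1 hi).trans ht))
  have hM := mul_meas_ge_le_lintegral (μ := P) hmeas
    (ENNReal.ofReal (Real.exp (r - k * (l ^ 2 * σ ^ 2 / 2))))
  have hsub : {ω | (occurring D t ω).card = k ∧ r ≤ l * ∑ i ∈ occurring D t ω, W i ω} ⊆
      {ω | ENNReal.ofReal (Real.exp (r - k * (l ^ 2 * σ ^ 2 / 2))) ≤
        ∏ i ∈ Finset.range t, tiltFactor σ l (D i) (W i) ω} := by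
    rintro ω ⟨h1, h2⟩
    simp only [Set.mem_ofPred_eq, prod_tiltFactor_eq, h1]
    gcongr
  have hone := hI.lintegral_prod_tiltFactor_le_one ht D hD l le_rfl
  calc _ = ENNReal.ofReal (Real.exp (k * (l ^ 2 * σ ^ 2 / 2) - r)) *
        (ENNReal.ofReal (Real.exp (r - k * (l ^ 2 * σ ^ 2 / 2))) *
          P {ω | (occurring D t ω).card = k ∧ r ≤ l * ∑ i ∈ occurring D t ω, W i ω}) := by
        rw [← mul_assoc, ← ENNReal.ofReal_mul (Real.exp_pos _).le, ← Real.exp_add]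
        simp
    _ ≤ ENNReal.ofReal (Real.exp (k * (l ^ 2 * σ ^ 2 / 2) - r)) * 1 := by
        gcongr
        exact ((mul_le_mul_right (measure_mono hsub) _).trans hM).trans hone
    _ = _ := mul_one _

/-- Without a variance term the tilt may be taken arbitrarily large, and the Chernoff bound `exp
(-r)` tends to zero. This covers `σ = 0`, where the optimal tilt `b / σ²` is meaningless. -/
lemma IsInteraction.measure_pos_sum_eq_zero [IsProbabilityMeasure P]
    (hI : IsInteraction P ν 0 T X W A) {t : ℕ} (ht : t < T) (D : ℕ → Set Ω)
    (hD : ∀ i < t, MeasurableSet[infoSigma X W A i ⊔ futureSigma X i t] (D i)) (s : ℝ) (k : ℕ) :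
    P {ω | (occurring D t ω).card = k ∧ 0 < s * ∑ i ∈ occurring D t ω, W i ω} = 0 := by
  have hsub : {ω | (occurring D t ω).card = k ∧ 0 < s * ∑ i ∈ occurring D t ω, W i ω} ⊆
      ⋃ n : ℕ, {ω | (occurring D t ω).card = k ∧
        1 / ((n : ℝ) + 1) ≤ s * ∑ i ∈ occurring D t ω, W i ω} := by
    rintro ω ⟨h1, h2⟩
    obtain ⟨n, hn⟩ := exists_nat_one_div_lt h2
    exact Set.mem_iUnion.2 ⟨n, h1, hn.le⟩
  refine measure_mono_null hsub (measure_iUnion_null fun n => ?_)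
  refine le_antisymm ?_ zero_le
  have hlim : Filter.Tendsto (fun r : ℝ => ENNReal.ofReal (Real.exp (-r))) Filter.atTop (nhds 0) := by
    have := (ENNReal.continuous_ofReal.tendsto 0).comp Real.tendsto_exp_neg_atTop_nhds_zero
    simpa [Function.comp_def] using this
  refine ge_of_tendsto hlim (Filter.eventually_atTop.2 ⟨0, fun r hr => ?_⟩)
  have h := hI.measure_chernoff ht D hD (r * ((n : ℝ) + 1) * s) r k
  have hz : (k : ℝ) * ((r * ((n : ℝ) + 1) * s) ^ 2 * 0 ^ 2 / 2) - r = -r := by ring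
  rw [hz] at h
  refine (measure_mono ?_).trans h
  rintro ω ⟨h1, h2⟩
  refine ⟨h1, ?_⟩
  have hn : (0 : ℝ) < (n : ℝ) + 1 := by positivity
  rw [div_le_iff₀ hn] at h2
  nlinarith

lemma IsInteraction.measure_signed_sum_le [IsProbabilityMeasure P]
    (hI : IsInteraction P ν σ T X W A) (hσ : 0 ≤ σ) {t : ℕ} (ht : t < T) (D : ℕ → Set Ω)
    (hD : ∀ i < t, MeasurableSet[infoSigma X W A i ⊔ futureSigma X i t] (D i)) {s : ℝ}
    (hs : s ^ 2 = 1) {m k : ℕ} (hk : 1 ≤ k) (hlog : 1 ≤ logArg d T m) :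
    P {ω | (occurring D t ω).card = k ∧
      k * bonus d T m k σ < s * ∑ i ∈ occurring D t ω, W i ω} ≤
        ENNReal.ofReal (1 / logArg d T m) := by
  have hk0 : (0 : ℝ) < k := by exact_mod_cast hk
  have hb0 : 0 ≤ bonus d T m k σ := Real.sqrt_nonneg _
  rcases hσ.eq_or_lt with rfl | hσ
  · have hz := hI.measure_pos_sum_eq_zero ht D hD s k
    refine le_of_eq_of_le (measure_mono_null ?_ hz) zero_le
    rintro ω ⟨h1, h2⟩
    exact ⟨h1, lt_of_le_of_lt (by positivity) h2⟩
  · have hb2 : bonus d T m k σ ^ 2 = 2 * σ ^ 2 / k * Real.log (logArg d T m) :=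
      Real.sq_sqrt (mul_nonneg (by positivity) (Real.log_nonneg hlog))
    set b := bonus d T m k σ
    -- The tilt `b / σ²` minimizes the Chernoff exponent at level `k b`; the minimum `-k b² / (2σ²)`
    -- is minus the logarithm in the bonus.
    have h := hI.measure_chernoff ht D hD (b / σ ^ 2 * s) (b / σ ^ 2 * (k * b)) k
    have he : (k : ℝ) * ((b / σ ^ 2 * s) ^ 2 * σ ^ 2 / 2) - b / σ ^ 2 * (k * b)
        = - Real.log (logArg d T m) := by
      have e1 : (k : ℝ) * ((b / σ ^ 2 * s) ^ 2 * σ ^ 2 / 2) - b / σ ^ 2 * (k * b)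
        = - (k / (2 * σ ^ 2) * b ^ 2) := by
        rw [mul_pow, hs]; field_simp; ring
      rw [e1, hb2]; field_simp
    rw [he, Real.exp_neg, Real.exp_log (by linarith), ← one_div] at h
    refine (measure_mono ?_).trans h
    rintro ω ⟨h1, h2⟩
    refine ⟨h1, ?_⟩
    rw [mul_assoc]
    exact mul_le_mul_of_nonneg_left h2.le (by positivity)

end Concentration

lemma one_le_logArg {d T m : ℕ} (hd : 1 ≤ d) (hT : 1 ≤ T) (hm : 1 ≤ m) : 1 ≤ logArg d T m := by
  have : 1 ≤ d * T ^ (2 * d + 2) * m := Nat.one_le_iff_ne_zero.2 (by positivity)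
  unfold logArg
  exact_mod_cast this

/-- The cost of the union over times, arms and pivots. A third power of `T` suffices: two for the
union, one to offset regret of order `T` on the bad event. -/
lemma card_mul_div_logArg_le {d T m : ℕ} (hd : 1 ≤ d) (hT : 1 ≤ T) (hm : 1 ≤ m) :
    (T : ℝ) * (m * (T * (2 * (1 / logArg d T m)))) ≤ 2 / T := by
  have hL := one_le_logArg hd hT hm
  have hT0 : (0 : ℝ) < T := by exact_mod_cast hT
  have h : T * (m * T) * T ≤ d * T ^ (2 * d + 2) * m := by
    calc T * (m * T) * T = 1 * T ^ 3 * m := by ring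
      _ ≤ d * T ^ (2 * d + 2) * m := by gcongr; omega
  have h' : (T : ℝ) * (m * T) * T ≤ logArg d T m := by
    unfold logArg; exact_mod_cast h
  rw [show (T : ℝ) * (m * (T * (2 * (1 / logArg d T m)))) = 2 * (T * (m * T)) / logArg d T m by ring,
    div_le_div_iff₀ (by linarith) hT0]
  linarith

/-! ### Ties in distance have probability zero -/

section Ties

variable {d : ℕ} {𝒜 : Type*} {Ω : Type*} [MeasurableSpace 𝒜]
  [mΩ : MeasurableSpace Ω] {P : Measure Ω} {ν : Measure (Ctx d)} {σ : ℝ} {T : ℕ}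
  {X : ℕ → Ω → Ctx d} {W : ℕ → Ω → ℝ} {A : ℕ → Ω → 𝒜}

lemma contextLaw_absolutelyContinuous (𝒳 : Set (Ctx d)) (f : Ctx d → ℝ) :
    contextLaw 𝒳 f ≪ volume :=
  (withDensity_absolutelyContinuous _ _).trans Measure.restrict_le_self.absolutelyContinuous

/-- The equidistant points form the perpendicular bisector, a proper affine subspace since `u ≠ v`.
-/
lemma volume_equidistant_eq_zero {u v : Ctx d} (h : u ≠ v) :
    volume {x : Ctx d | ‖u - x‖ = ‖v - x‖} = 0 := by
  have := Measure.addHaar_affineSubspace (volume : Measure (Ctx d))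
    (AffineSubspace.perpBisector u v) (by simpa using h)
  convert this using 2
  ext x
  simp [AffineSubspace.mem_perpBisector_iff_dist_eq', dist_eq_norm]

lemma ae_notMem_of_indepFun [IsProbabilityMeasure P] {α β : Type*} [MeasurableSpace α]
    [MeasurableSpace β] {Y : Ω → α} {Z : Ω → β} (hY : Measurable Y) (hZ : Measurable Z)
    (hind : IndepFun Y Z P) {s : Set (α × β)} (hs : MeasurableSet s)
    (h : ∀ᵐ ω ∂P, P.map Z (Prod.mk (Y ω) ⁻¹' s) = 0) : ∀ᵐ ω ∂P, (Y ω, Z ω) ∉ s := by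
  have : IsProbabilityMeasure (P.map Z) := Measure.isProbabilityMeasure_map hZ.aemeasurable
  have h0 : P.map (fun ω => (Y ω, Z ω)) s = 0 := by
    rw [(indepFun_iff_map_prod_eq_prod_map_map hY.aemeasurable hZ.aemeasurable).1 hind,
      Measure.measure_prod_null hs]
    exact (ae_map_iff hY.aemeasurable
      (measurable_measure_prodMk_left hs (measurableSet_singleton 0))).2 h
  rw [Measure.map_apply (hY.prodMk hZ) hs] at h0
  exact measure_eq_zero_iff_ae_notMem.1 h0

/-- Almost surely, no two earlier contexts have the same distance to the current one. -/
lemma IsInteraction.ae_norm_sub_ne [IsProbabilityMeasure P] (hI : IsInteraction P ν σ T X W A)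
    (hd : 1 ≤ d) (hν : ν ≪ volume) {i j t : ℕ} (hij : i < j) (hjt : j < t) (ht : t < T) :
    ∀ᵐ ω ∂P, ‖X i ω - X t ω‖ ≠ ‖X j ω - X t ω‖ := by
  -- In dimension zero a single point would have positive volume.
  have : Nonempty (Fin d) := ⟨⟨0, hd⟩⟩
  have hXi := hI.measurable_context i (by omega)
  have hXj := hI.measurable_context j (by omega)
  have hXt := hI.measurable_context t ht
  -- Coincident contexts are excluded first: their set of equidistant points is the whole space.
  have hne : ∀ᵐ ω ∂P, X i ω ≠ X j ω := by
    have hind : IndepFun (X i) (X j) P := by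
      rw [IndepFun_iff_Indep]
      exact indep_of_indep_of_le_left (hI.context_indep j (by omega)).symm
        (comap_context_le_pastSigma X W A hij)
    have hs : MeasurableSet {p : Ctx d × Ctx d | p.1 = p.2} :=
      measurableSet_eq_fun measurable_fst measurable_snd
    refine ae_notMem_of_indepFun hXi hXj hind hs (Filter.Eventually.of_forall fun ω => ?_)
    rw [hI.context_law j (by omega)]
    refine hν ?_
    convert measure_singleton (μ := (volume : Measure (Ctx d))) (X i ω) using 2
    ext x
    simp [eq_comm]
  have hind : IndepFun (fun ω => (X i ω, X j ω)) (X t) P := by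
    rw [IndepFun_iff_Indep]
    refine indep_of_indep_of_le_left (hI.context_indep t ht).symm ?_
    rw [← measurable_iff_comap_le]
    exact Measurable.prodMk
      (measurable_iff_comap_le.2 (comap_context_le_pastSigma X W A (hij.trans hjt)))
      (measurable_iff_comap_le.2 (comap_context_le_pastSigma X W A hjt))
  have hs : MeasurableSet {p : (Ctx d × Ctx d) × Ctx d | ‖p.1.1 - p.2‖ = ‖p.1.2 - p.2‖} :=
    measurableSet_eq_fun (measurable_fst.fst.sub measurable_snd).norm
      (measurable_fst.snd.sub measurable_snd).norm
  refine ae_notMem_of_indepFun (hXi.prodMk hXj) hXt hind hs ?_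
  filter_upwards [hne] with ω hω
  rw [hI.context_law t ht]
  exact hν (volume_equidistant_eq_zero hω)

end Ties

/-! ### Uniform control of the noise in neighbour averages -/

section Deviation

variable {d : ℕ} {𝒜 : Type*} {Ω : Type*}

/-- The event that arm `a` is pulled at step `i` and the context of step `i` is at least as close
to the context of step `t` as that of step `j`. -/
def closerPull (X : ℕ → Ω → Ctx d) (A : ℕ → Ω → 𝒜) (t : ℕ) (a : 𝒜) (j i : ℕ) : Set Ω :=
  {ω | A i ω = a ∧ ‖X i ω - X t ω‖ ≤ ‖X j ω - X t ω‖}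

/-- If there are no ties, then the nearest neighbours are the points in a ball. -/
lemma IsKNearest.exists_eq_filter {X : ℕ → Ctx d} {k : ℕ} {x : Ctx d} {S N : Finset ℕ}
    (h : IsKNearest X k x S N) (hk : 1 ≤ k)
    (hne : ∀ i ∈ S, ∀ j ∈ S, i ≠ j → ‖X i - x‖ ≠ ‖X j - x‖) :
    ∃ j ∈ N, N = S.filter fun i => ‖X i - x‖ ≤ ‖X j - x‖ := by
  have hN : N.Nonempty := Finset.card_pos.1 (by rw [h.card_eq]; exact hk)
  obtain ⟨j, hj, hmax⟩ := N.exists_max_image (fun i => ‖X i - x‖) hN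
  refine ⟨j, hj, ?_⟩
  ext i
  rw [Finset.mem_filter]
  refine ⟨fun hi => ⟨h.subset hi, hmax i hi⟩, fun ⟨hi, hle⟩ => ?_⟩
  by_contra hiN
  have := h.nearest j hj i hi hiN
  exact hne i hi j (h.subset hj) (fun hij => hiN (hij ▸ hj)) (le_antisymm hle this)

variable [MeasurableSpace 𝒜] [MeasurableSingletonClass 𝒜]

/-- Besides `A i` the event involves only contexts up to time `t`. The pivot `j` may come after `i`,
and `t` does, which is why future contexts have to be adjoined. -/
lemma measurableSet_closerPull (X : ℕ → Ω → Ctx d) (W : ℕ → Ω → ℝ) (A : ℕ → Ω → 𝒜) {t : ℕ}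
    (a : 𝒜) {j : ℕ} (hj : j < t) {i : ℕ} (hi : i < t) :
    MeasurableSet[infoSigma X W A i ⊔ futureSigma X i t] (closerPull X A t a j i) := by
  have hX : ∀ s ≤ t, Measurable[infoSigma X W A i ⊔ futureSigma X i t] (X s) := fun s hs =>
    measurable_iff_comap_le.2 (comap_context_le_info_sup_future X W A hs)
  let _ : MeasurableSpace Ω := infoSigma X W A i ⊔ futureSigma X i t
  have hA : Measurable (A i) :=
    measurable_iff_comap_le.2 (le_sup_right.trans le_sup_left)
  refine MeasurableSet.inter (hA (measurableSet_singleton a)) ?_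
  exact measurableSet_le ((hX i hi.le).sub (hX t le_rfl)).norm ((hX j hj.le).sub (hX t le_rfl)).norm

variable [mΩ : MeasurableSpace Ω] {P : Measure Ω} {ν : Measure (Ctx d)} {σ : ℝ} {T : ℕ}
  {X : ℕ → Ω → Ctx d} {W : ℕ → Ω → ℝ} {A : ℕ → Ω → 𝒜}

lemma IsInteraction.measure_abs_sum_le [IsProbabilityMeasure P]
    (hI : IsInteraction P ν σ T X W A) (hσ : 0 ≤ σ) {t : ℕ} (ht : t < T) (a : 𝒜) {j : ℕ}
    (hj : j < t) {m k : ℕ} (hk : 1 ≤ k) (hlog : 1 ≤ logArg d T m) :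
    P {ω | (occurring (closerPull X A t a j) t ω).card = k ∧
      k * bonus d T m k σ < |∑ i ∈ occurring (closerPull X A t a j) t ω, W i ω|} ≤
        ENNReal.ofReal (2 * (1 / logArg d T m)) := by
  have hD := fun i hi => measurableSet_closerPull X W A a hj (t := t) (i := i) hi
  have h1 := hI.measure_signed_sum_le hσ ht (closerPull X A t a j) hD (s := 1) (by norm_num) hk hlog
  have h2 := hI.measure_signed_sum_le hσ ht (closerPull X A t a j) hD (s := -1) (by norm_num) hk
    hlog
  have hp : 0 ≤ 1 / logArg d T m := by positivity
  rw [two_mul, ENNReal.ofReal_add hp hp]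
  refine (measure_mono ?_).trans ((measure_union_le _ _).trans (add_le_add h1 h2))
  rintro ω ⟨hc, h⟩
  rcases lt_abs.1 h with h | h
  · exact Or.inl ⟨hc, by simpa using h⟩
  · exact Or.inr ⟨hc, by simpa using h⟩

/-- Outside an event of small probability, the noise of all nearest neighbour averages is at most
the bonus. -/
theorem IsInteraction.exists_deviation_event [IsProbabilityMeasure P] [Fintype 𝒜] [Nonempty 𝒜]
    [DecidableEq 𝒜]
    (hI : IsInteraction P ν σ T X W A) (hσ : 0 ≤ σ) (hd : 1 ≤ d) (hν : ν ≪ volume) (hT : 1 ≤ T)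
    {k : ℕ} (hk : 1 ≤ k) :
    ∃ B : Set Ω, MeasurableSet B ∧ P B ≤ ENNReal.ofReal (2 / T) ∧
      ∀ᵐ ω ∂P, ω ∉ B → ∀ t < T, ∀ a N,
        IsKNearest (fun i => X i ω) k (X t ω) (pulls (fun i => A i ω) t a) N →
          |∑ i ∈ N, W i ω| ≤ k * bonus d T (Fintype.card 𝒜) k σ := by
  have hm : 1 ≤ Fintype.card 𝒜 := Fintype.card_pos
  have hlog := one_le_logArg hd hT hm
  -- The pivot `j` stands for the random radius, so finitely many events suffice.
  set E : ℕ → 𝒜 → ℕ → Set Ω := fun t a j => {ω | (occurring (closerPull X A t a j) t ω).card = k ∧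
      k * bonus d T (Fintype.card 𝒜) k σ <
        |∑ i ∈ occurring (closerPull X A t a j) t ω, W i ω|} with hE
  set U : Set Ω := ⋃ t ∈ Finset.range T, ⋃ a ∈ Finset.univ, ⋃ j ∈ Finset.range t, E t a j with hU
  have hPU : P U ≤ ENNReal.ofReal (2 / T) := by
    calc P U ≤ ∑ t ∈ Finset.range T, ∑ a : 𝒜, ∑ j ∈ Finset.range t, P (E t a j) := by
          refine (measure_biUnion_finset_le _ _).trans (Finset.sum_le_sum fun t _ => ?_)
          refine (measure_biUnion_finset_le _ _).trans (Finset.sum_le_sum fun a _ => ?_)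
          exact measure_biUnion_finset_le _ _
      _ ≤ ∑ t ∈ Finset.range T, ∑ a : 𝒜, ∑ j ∈ Finset.range T,
            ENNReal.ofReal (2 * (1 / logArg d T (Fintype.card 𝒜))) := by
          refine Finset.sum_le_sum fun t ht => Finset.sum_le_sum fun a _ => ?_
          have htT := Finset.mem_range.1 ht
          refine (Finset.sum_le_sum fun j hj => hI.measure_abs_sum_le hσ htT a
            (Finset.mem_range.1 hj) hk hlog).trans ?_
          exact Finset.sum_le_sum_of_subset (Finset.range_subset_range.2 htT.le)
      _ = ENNReal.ofReal (T * (Fintype.card 𝒜 *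
            (T * (2 * (1 / logArg d T (Fintype.card 𝒜)))))) := by
          have hp : 0 ≤ 2 * (1 / logArg d T (Fintype.card 𝒜)) := by positivity
          rw [ENNReal.ofReal_mul (by positivity), ENNReal.ofReal_mul (by positivity),
            ENNReal.ofReal_mul (by positivity)]
          simp
      _ ≤ ENNReal.ofReal (2 / T) := ENNReal.ofReal_le_ofReal (card_mul_div_logArg_le hd hT hm)
  -- The measurable hull has the same probability and makes a measurability proof for `U`
  -- unnecessary.
  refine ⟨toMeasurable P U, measurableSet_toMeasurable _ _, by rwa [measure_toMeasurable], ?_⟩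
  have hties : ∀ᵐ ω ∂P, ∀ t < T, ∀ j < t, ∀ i < j, ‖X i ω - X t ω‖ ≠ ‖X j ω - X t ω‖ := by
    refine ae_all_iff.2 fun t => ae_all_iff.2 fun ht => ae_all_iff.2 fun j => ae_all_iff.2 fun hj =>
      ae_all_iff.2 fun i => ae_all_iff.2 fun hi => hI.ae_norm_sub_ne hd hν hi hj ht
  filter_upwards [hties] with ω hω hωU t ht a N hN
  replace hωU : ω ∉ U := fun h => hωU (subset_toMeasurable P U h)
  obtain ⟨j, hj, hNj⟩ := hN.exists_eq_filter hk fun i hi i' hi' hne => by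
    have hit := Finset.mem_range.1 (Finset.mem_filter.1 hi).1
    have hit' := Finset.mem_range.1 (Finset.mem_filter.1 hi').1
    rcases lt_or_gt_of_ne hne with h | h
    · exact hω t ht i' hit' i h
    · exact (hω t ht i hit i' h).symm
  have hjt : j < t := Finset.mem_range.1 (Finset.mem_filter.1 (hN.subset hj)).1
  have hocc : occurring (closerPull X A t a j) t ω = N := by
    rw [hNj]
    ext i
    simp [mem_occurring, closerPull, pulls, and_assoc]
  by_contra! hlt
  refine hωU ?_
  simp only [hU, Set.mem_iUnion]
  refine ⟨t, Finset.mem_range.2 ht, a, Finset.mem_univ a, j, Finset.mem_range.2 hjt, ?_, ?_⟩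
  · rw [hocc, hN.card_eq]
  · rw [hocc]; exact hlt

end Deviation

/-! ### Regularity of the gap and the neighbour radius -/

section Gap

variable {d : ℕ} {𝒜 : Type*} [Fintype 𝒜] {η : 𝒜 → Ctx d → ℝ}

lemma le_bestReward (η : 𝒜 → Ctx d → ℝ) (a : 𝒜) (x : Ctx d) : η a x ≤ bestReward η x :=
  le_ciSup (f := fun a => η a x) (Set.finite_range _).bddAbove a

lemma gap_nonneg (η : 𝒜 → Ctx d → ℝ) (a : 𝒜) (x : Ctx d) : 0 ≤ gap η a x :=
  sub_nonneg.2 (le_bestReward η a x)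

lemma exists_eq_bestReward [Nonempty 𝒜] (η : 𝒜 → Ctx d → ℝ) (x : Ctx d) :
    ∃ a, η a x = bestReward η x :=
  exists_eq_ciSup_of_finite (f := fun a => η a x)

/-- An arm optimal at `x` is a competitor at `x'`; that arm and `a` each lose at most `L ‖x - x'‖`.
-/
lemma gap_sub_gap_le [Nonempty 𝒜] {L : ℝ} {𝒳 : Set (Ctx d)}
    (hη : ∀ a, ∀ x ∈ 𝒳, ∀ x' ∈ 𝒳, |η a x - η a x'| ≤ L * ‖x - x'‖) (a : 𝒜) {x x' : Ctx d}
    (hx : x ∈ 𝒳) (hx' : x' ∈ 𝒳) : gap η a x - gap η a x' ≤ 2 * L * ‖x - x'‖ := by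
  obtain ⟨b, hb⟩ := exists_eq_bestReward η x
  have h1 := le_bestReward η b x'
  have h2 := (abs_le.1 (hη b x hx x' hx')).2
  have h3 := (abs_le.1 (hη a x hx x' hx')).1
  unfold gap
  linarith

lemma continuousOn_gap [Nonempty 𝒜] {L : ℝ} (hL : 0 ≤ L) {𝒳 : Set (Ctx d)}
    (hη : ∀ a, ∀ x ∈ 𝒳, ∀ x' ∈ 𝒳, |η a x - η a x'| ≤ L * ‖x - x'‖) (a : 𝒜) :
    ContinuousOn (gap η a) 𝒳 := by
  have : LipschitzOnWith (Real.toNNReal (2 * L)) (gap η a) 𝒳 := by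
    refine LipschitzOnWith.of_dist_le_mul fun x hx y hy => ?_
    rw [Real.coe_toNNReal _ (by positivity), Real.dist_eq, dist_eq_norm, abs_le]
    have h1 := gap_sub_gap_le hη a hx hy
    have h2 := gap_sub_gap_le hη a hy hx
    rw [norm_sub_rev] at h2
    constructor <;> linarith
  exact this.continuousOn

end Gap

section Neighbours

variable {d : ℕ} {X : ℕ → Ctx d} {x : Ctx d} {S N : Finset ℕ} {k : ℕ}

lemma norm_sub_le_knnRadius {i : ℕ} (hi : i ∈ N) : ‖X i - x‖ ≤ knnRadius X x N :=
  le_ciSup (f := fun i : N => ‖X i - x‖) (Set.finite_range _).bddAbove ⟨i, hi⟩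

lemma knnRadius_nonneg : 0 ≤ knnRadius X x N :=
  Real.iSup_nonneg fun _ => norm_nonneg _

/-- A point strictly closer than the radius must belong to `N`, and the point of `N` attaining the
radius is not among them. -/
lemma IsKNearest.card_filter_lt (h : IsKNearest X k x S N) (hk : 1 ≤ k) {r : ℝ}
    (hr : r ≤ knnRadius X x N) : (S.filter fun i => ‖X i - x‖ < r).card < k := by
  have hN : N.Nonempty := Finset.card_pos.1 (by rw [h.card_eq]; exact hk)
  have : Nonempty N := hN.to_subtype
  obtain ⟨⟨j, hj⟩, hjr⟩ := exists_eq_ciSup_of_finite (f := fun i : N => ‖X i - x‖)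
  rw [← h.card_eq]
  refine Finset.card_lt_card ⟨fun i hi => ?_, fun hsub => ?_⟩
  · rw [Finset.mem_filter] at hi
    by_contra hiN
    have h1 := h.nearest j hj i hi.1 hiN
    have h2 : ‖X j - x‖ = knnRadius X x N := hjr
    linarith [hi.2]
  · have h1 := (Finset.mem_filter.1 (hsub hj)).2
    have h2 : ‖X j - x‖ = knnRadius X x N := hjr
    linarith

end Neighbours

/-! ### Consequences of the UCB rule along one trajectory -/

section Trajectory

variable {d : ℕ} {𝒜 : Type*} [DecidableEq 𝒜] {η : 𝒜 → Ctx d → ℝ}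
  {𝒳 : Set (Ctx d)} {X : ℕ → Ctx d} {W : ℕ → ℝ} {A : ℕ → 𝒜} {σ L : ℝ} {T k : ℕ}

lemma abs_average_sub_le (hL : 0 ≤ L)
    (hη : ∀ a, ∀ x ∈ 𝒳, ∀ x' ∈ 𝒳, |η a x - η a x'| ≤ L * ‖x - x'‖) {t : ℕ}
    (hX : ∀ i ≤ t, X i ∈ 𝒳) (hk : 1 ≤ k) {a : 𝒜} {N : Finset ℕ}
    (hN : IsKNearest X k (X t) (pulls A t a) N) {b : ℝ} (hW : |∑ i ∈ N, W i| ≤ k * b) :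
    |1 / (k : ℝ) * ∑ i ∈ N, (η (A i) (X i) + W i) - η a (X t)| ≤
      b + L * knnRadius X (X t) N := by
  have hk0 : (0 : ℝ) < k := by exact_mod_cast hk
  have h1 : |∑ i ∈ N, (η (A i) (X i) - η a (X t))| ≤ k * (L * knnRadius X (X t) N) := by
    refine (Finset.abs_sum_le_sum_abs _ _).trans ?_
    rw [← hN.card_eq, ← nsmul_eq_mul]
    refine Finset.sum_le_card_nsmul _ _ _ fun i hi => ?_
    have hi' := Finset.mem_filter.1 (hN.subset hi)
    rw [hi'.2]
    exact (hη a _ (hX i (Finset.mem_range.1 hi'.1).le) _ (hX t le_rfl)).trans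
      (mul_le_mul_of_nonneg_left (norm_sub_le_knnRadius hi) hL)
  have h2 : 1 / (k : ℝ) * ∑ i ∈ N, (η (A i) (X i) + W i) - η a (X t) =
      (∑ i ∈ N, (η (A i) (X i) - η a (X t)) + ∑ i ∈ N, W i) / k := by
    rw [Finset.sum_add_distrib, Finset.sum_sub_distrib, Finset.sum_const, hN.card_eq, nsmul_eq_mul]
    field_simp
    ring
  rw [h2, abs_div, abs_of_pos hk0, div_le_iff₀ hk0]
  calc _ ≤ _ := abs_add_le _ _
    _ ≤ k * (L * knnRadius X (X t) N) + k * b := add_le_add h1 hW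
    _ = _ := by ring

variable [Fintype 𝒜] [Nonempty 𝒜]

/-- Where the noise averages are at most the bonus, an arm which has been pulled often enough is
only pulled at a context whose gap is controlled by the nearest neighbour distance. -/
lemma exists_gap_le_of_selectsUCB (hL : 0 ≤ L)
    (hη : ∀ a, ∀ x ∈ 𝒳, ∀ x' ∈ 𝒳, |η a x - η a x'| ≤ L * ‖x - x'‖) {t : ℕ}
    (hX : ∀ i ≤ t, X i ∈ 𝒳) (hk : 1 ≤ k)
    (hsel : SelectsUCB σ L T k X (fun i => η (A i) (X i) + W i) A t)
    (hW : ∀ a N, IsKNearest X k (X t) (pulls A t a) N →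
      |∑ i ∈ N, W i| ≤ k * bonus d T (Fintype.card 𝒜) k σ)
    (hcard : k ≤ (pulls A t (A t)).card) :
    ∃ N, IsKNearest X k (X t) (pulls A t (A t)) N ∧ gap η (A t) (X t) ≤
      2 * bonus d T (Fintype.card 𝒜) k σ + 2 * L * knnRadius X (X t) N := by
  obtain ⟨N, hN, hle⟩ := hsel
  obtain ⟨a, ha⟩ := exists_eq_bestReward η (X t)
  refine ⟨N (A t), hN _ hcard, ?_⟩
  have h := hle a
  simp only [ucb, if_pos hcard] at h
  split_ifs at h with hca
  · rw [EReal.coe_le_coe_iff] at h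
    have h1 := (abs_le.1 (abs_average_sub_le hL hη hX hk (hN a hca) (hW a _ (hN a hca)))).1
    have h2 := (abs_le.1 (abs_average_sub_le hL hη hX hk (hN _ hcard) (hW _ _ (hN _ hcard)))).2
    unfold gap
    linarith
  -- If the best arm had fewer than `k` pulls, its infinite bound would beat the finite one of the
  -- pulled arm.
  · exact absurd (top_le_iff.1 h) (EReal.coe_ne_top _)

/-- A pull with a large gap has few earlier pulls of the same arm in its neighbourhood. -/
lemma card_close_pulls_lt (hL : 0 ≤ L)
    (hη : ∀ a, ∀ x ∈ 𝒳, ∀ x' ∈ 𝒳, |η a x - η a x'| ≤ L * ‖x - x'‖) {t : ℕ}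
    (hX : ∀ i ≤ t, X i ∈ 𝒳) (hk : 1 ≤ k)
    (hsel : SelectsUCB σ L T k X (fun i => η (A i) (X i) + W i) A t)
    (hW : ∀ a N, IsKNearest X k (X t) (pulls A t a) N →
      |∑ i ∈ N, W i| ≤ k * bonus d T (Fintype.card 𝒜) k σ)
    (hcard : k ≤ (pulls A t (A t)).card)
    (hgap : 4 * bonus d T (Fintype.card 𝒜) k σ ≤ gap η (A t) (X t)) :
    ((pulls A t (A t)).filter fun i =>
      ‖X i - X t‖ < gap η (A t) (X t) / (4 * (L + 1))).card < k := by
  obtain ⟨N, hN, hle⟩ := exists_gap_le_of_selectsUCB hL hη hX hk hsel hW hcard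
  refine hN.card_filter_lt hk ?_
  have hρ : 0 ≤ knnRadius X (X t) N := knnRadius_nonneg
  rw [div_le_iff₀ (by positivity)]
  linarith

/-- Gaps at centres of balls containing `y` are comparable to the gap at `y`, hence to each other.
All these centres are then close to the latest one, whose neighbourhood holds fewer than `k` earlier
pulls. -/
lemma card_filter_mem_ball_le (hL : 0 ≤ L)
    (hη : ∀ a, ∀ x ∈ 𝒳, ∀ x' ∈ 𝒳, |η a x - η a x'| ≤ L * ‖x - x'‖) {a : 𝒜} {κ : ℝ} (hκ : 0 < κ)
    (hκL : 32 * (L + 1) * κ ≤ 1) {I : Finset ℕ} (hI : ∀ t ∈ I, A t = a ∧ X t ∈ 𝒳 ∧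
      0 < gap η a (X t) ∧ ((pulls A t a).filter fun i =>
        ‖X i - X t‖ < gap η a (X t) / (4 * (L + 1))).card < k) {y : Ctx d} (hy : y ∈ 𝒳) :
    (∀ t ∈ I, ‖y - X t‖ ≤ κ * gap η a (X t) →
      gap η a (X t) ≤ 2 * gap η a y ∧ gap η a y ≤ 2 * gap η a (X t)) ∧
    (I.filter fun t => ‖y - X t‖ ≤ κ * gap η a (X t)).card ≤ k := by
  have hcomp : ∀ t ∈ I, ‖y - X t‖ ≤ κ * gap η a (X t) →
      gap η a (X t) ≤ 2 * gap η a y ∧ gap η a y ≤ 2 * gap η a (X t) := by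
    intro t ht hle
    obtain ⟨-, hXt, hg, -⟩ := hI t ht
    have h1 := gap_sub_gap_le hη a hy hXt
    have h2 := gap_sub_gap_le hη a hXt hy
    rw [norm_sub_rev] at h2
    have h3 : 2 * L * ‖y - X t‖ ≤ gap η a (X t) / 16 := by
      calc 2 * L * ‖y - X t‖ ≤ 2 * (L + 1) * (κ * gap η a (X t)) := by gcongr; linarith
        _ = 32 * (L + 1) * κ * gap η a (X t) / 16 := by ring
        _ ≤ 1 * gap η a (X t) / 16 := by gcongr
        _ = _ := by ring
    constructor <;> linarith
  refine ⟨hcomp, ?_⟩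
  set J := I.filter fun t => ‖y - X t‖ ≤ κ * gap η a (X t) with hJ
  rcases J.eq_empty_or_nonempty with h0 | hne
  · simp [h0]
  set t := J.max' hne with ht
  have htJ : t ∈ J := J.max'_mem hne
  obtain ⟨htI, htb⟩ := Finset.mem_filter.1 htJ
  obtain ⟨hAt, hXt, hg, hlt⟩ := hI t htI
  have hsub : J.erase t ⊆ (pulls A t a).filter fun i =>
      ‖X i - X t‖ < gap η a (X t) / (4 * (L + 1)) := by
    intro s hs
    obtain ⟨hst, hsJ⟩ := Finset.mem_erase.1 hs
    obtain ⟨hsI, hsb⟩ := Finset.mem_filter.1 hsJ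
    have hlt : s < t := lt_of_le_of_ne (J.le_max' s hsJ) hst
    refine Finset.mem_filter.2 ⟨Finset.mem_filter.2 ⟨Finset.mem_range.2 hlt, (hI s hsI).1⟩, ?_⟩
    have h1 : gap η a (X s) ≤ 4 * gap η a (X t) := by
      linarith [(hcomp s hsI hsb).1, (hcomp t htI htb).2]
    have h2 : ‖X s - X t‖ ≤ 5 * (κ * gap η a (X t)) := by
      calc ‖X s - X t‖ = ‖(y - X t) - (y - X s)‖ := by congr 1; abel
        _ ≤ ‖y - X t‖ + ‖y - X s‖ := norm_sub_le _ _
        _ ≤ κ * gap η a (X t) + κ * gap η a (X s) := add_le_add htb hsb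
        -- The constant 32 makes the resulting distance `5 κ gap` at most `5/8` of the radius `gap /
        -- (4(L+1))`.
        _ ≤ κ * gap η a (X t) + κ * (4 * gap η a (X t)) := by gcongr
        _ = _ := by ring
    refine h2.trans_lt ?_
    rw [lt_div_iff₀ (by positivity)]
    calc 5 * (κ * gap η a (X t)) * (4 * (L + 1))
        = 32 * (L + 1) * κ * (5 / 8 * gap η a (X t)) := by ring
      _ ≤ 1 * (5 / 8 * gap η a (X t)) := by gcongr
      _ < gap η a (X t) := by linarith
  have := Finset.card_le_card hsub
  rw [Finset.card_erase_of_mem htJ] at this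
  omega

end Trajectory

/-! ### Large gaps: packing of balls and the integral of the inverse gap -/

section LocalMass

variable {d : ℕ} {𝒜 : Type*} {η : 𝒜 → Ctx d → ℝ} {𝒳 : Set (Ctx d)} {f : Ctx d → ℝ}
  {α Cα L c c₀ r₀ M : ℝ}

/-- The volume of the unit ball. -/
noncomputable def unitBallVolume (d : ℕ) : ℝ := (volume (Metric.ball (0 : Ctx d) 1)).toReal

lemma unitBallVolume_pos (d : ℕ) : 0 < unitBallVolume d :=
  ENNReal.toReal_pos (Metric.measure_ball_pos _ _ one_pos).ne' measure_ball_lt_top.ne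

lemma IsBanditProblem.ae_mem (hp : IsBanditProblem α Cα L c c₀ r₀ M 𝒳 f η) :
    ∀ᵐ x ∂contextLaw 𝒳 f, x ∈ 𝒳 :=
  (withDensity_absolutelyContinuous _ _).ae_le (ae_restrict_mem hp.regular.measurableSet)

lemma IsBanditProblem.ofReal_le_contextLaw_closedBall
    (hp : IsBanditProblem α Cα L c c₀ r₀ M 𝒳 f η) (hc : 0 ≤ c) (hc₀ : 0 ≤ c₀) {x : Ctx d}
    (hx : x ∈ 𝒳) {r : ℝ} (hr : 0 < r) (hr' : r ≤ r₀) :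
    ENNReal.ofReal (c * c₀ * unitBallVolume d * r ^ d) ≤
      contextLaw 𝒳 f (Metric.closedBall x r) := by
  have hball : MeasurableSet (Metric.closedBall x r) := Metric.isClosed_closedBall.measurableSet
  have hv : volume (Metric.closedBall x r) = ENNReal.ofReal (unitBallVolume d * r ^ d) := by
    rw [Measure.addHaar_closedBall _ _ hr.le, finrank_euclideanSpace_fin, mul_comm (unitBallVolume d),
      ENNReal.ofReal_mul (by positivity), unitBallVolume,
      ENNReal.ofReal_toReal measure_ball_lt_top.ne]
  calc ENNReal.ofReal (c * c₀ * unitBallVolume d * r ^ d)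
      = ENNReal.ofReal c * (ENNReal.ofReal c₀ * volume (Metric.closedBall x r)) := by
        rw [hv, ← ENNReal.ofReal_mul hc₀, ← ENNReal.ofReal_mul hc]
        congr 1; ring
    _ ≤ ENNReal.ofReal c * volume (𝒳 ∩ Metric.closedBall x r) := by
        gcongr; exact hp.regular.volume_le x hx r hr hr'
    _ = ∫⁻ _ in 𝒳 ∩ Metric.closedBall x r, ENNReal.ofReal c := by simp
    _ ≤ ∫⁻ y in 𝒳 ∩ Metric.closedBall x r, ENNReal.ofReal (f y) := by
        refine setLIntegral_mono' (hp.regular.measurableSet.inter hball) fun y hy => ?_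
        exact ENNReal.ofReal_le_ofReal (hp.density_ge y hy.1)
    _ = contextLaw 𝒳 f (Metric.closedBall x r) := by
        rw [contextLaw, withDensity_apply _ hball, Measure.restrict_restrict hball, Set.inter_comm]

end LocalMass

section SumGap

variable {d : ℕ} {𝒜 : Type*} [Fintype 𝒜] [Nonempty 𝒜] [DecidableEq 𝒜] {η : 𝒜 → Ctx d → ℝ}
  {𝒳 : Set (Ctx d)} {f : Ctx d → ℝ} {α Cα L c c₀ r₀ M : ℝ} {X : ℕ → Ctx d} {A : ℕ → 𝒜} {k : ℕ}

open Classical in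
/-- The integrand `1 / gap^(d-1)`, restricted to gaps of at least `ε`. -/
noncomputable def gapWeight (η : 𝒜 → Ctx d → ℝ) (a : 𝒜) (ε : ℝ) (y : Ctx d) : ENNReal :=
  if ε ≤ gap η a y then ENNReal.ofReal (1 / gap η a y ^ (d - 1)) else 0

/-- Pulls of an arm which are locally few have a small total gap. -/
lemma IsBanditProblem.sum_gap_le (hp : IsBanditProblem α Cα L c c₀ r₀ M 𝒳 f η) (hd : 1 ≤ d)
    (hL : 0 ≤ L) (hc : 0 < c) (hc₀ : 0 < c₀) {a : 𝒜} {κ : ℝ} (hκ : 0 < κ)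
    (hκL : 32 * (L + 1) * κ ≤ 1) (hκr : κ * (|M| + 1) ≤ r₀) {u : ℝ} (hu : 0 < u) {I : Finset ℕ}
    (hI : ∀ t ∈ I, A t = a ∧ X t ∈ 𝒳 ∧ u ≤ gap η a (X t) ∧ ((pulls A t a).filter fun i =>
        ‖X i - X t‖ < gap η a (X t) / (4 * (L + 1))).card < k) :
    ∑ t ∈ I, ENNReal.ofReal (gap η a (X t)) ≤
      ENNReal.ofReal (k * (2 ^ (d - 1) / (c * c₀ * unitBallVolume d * κ ^ d))) *
        ∫⁻ y, gapWeight η a (u / 2) y ∂contextLaw 𝒳 f := by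
  set V := c * c₀ * unitBallVolume d with hV
  have hV0 : 0 < V := by have := unitBallVolume_pos d; positivity
  have hpos : ∀ t ∈ I, 0 < gap η a (X t) := fun t ht => hu.trans_le (hI t ht).2.2.1
  set w : ℕ → ℝ := fun t => V * (κ * gap η a (X t)) ^ d with hw
  have hw0 : ∀ t ∈ I, 0 < w t := fun t ht => by have := hpos t ht; positivity
  have hwd : ∀ t ∈ I, gap η a (X t) / w t = 1 / (V * κ ^ d) * (1 / gap η a (X t) ^ (d - 1)) := by
    intro t ht
    have hg := hpos t ht
    obtain ⟨e, rfl⟩ : ∃ e, d = e + 1 := ⟨d - 1, by omega⟩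
    simp only [hw, Nat.add_sub_cancel, mul_pow, pow_succ (gap η a (X t))]
    field_simp
  -- Each gap is spread over its ball, of mass at least `w t`; the density `gap / w t` is a multiple
  -- of `gap^(-(d-1))`.
  have hmass : ∀ t ∈ I, ENNReal.ofReal (gap η a (X t)) ≤
      ∫⁻ y, (Metric.closedBall (X t) (κ * gap η a (X t))).indicator
        (fun _ => ENNReal.ofReal (gap η a (X t) / w t)) y ∂contextLaw 𝒳 f := by
    intro t ht
    rw [lintegral_indicator_const Metric.isClosed_closedBall.measurableSet]
    have hXt := (hI t ht).2.1
    have hle : κ * gap η a (X t) ≤ r₀ := by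
      refine le_trans ?_ hκr
      gcongr
      linarith [hp.gap_le a _ hXt, le_abs_self M]
    have := hp.ofReal_le_contextLaw_closedBall hc.le hc₀.le hXt (mul_pos hκ (hpos t ht)) hle
    calc ENNReal.ofReal (gap η a (X t))
        = ENNReal.ofReal (gap η a (X t) / w t) * ENNReal.ofReal (w t) := by
          rw [← ENNReal.ofReal_mul (div_nonneg (hpos t ht).le (hw0 t ht).le),
            div_mul_cancel₀ _ (hw0 t ht).ne']
      _ ≤ _ := by gcongr
  calc ∑ t ∈ I, ENNReal.ofReal (gap η a (X t))
      ≤ ∑ t ∈ I, ∫⁻ y, (Metric.closedBall (X t) (κ * gap η a (X t))).indicator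
        (fun _ => ENNReal.ofReal (gap η a (X t) / w t)) y ∂contextLaw 𝒳 f :=
        Finset.sum_le_sum hmass
    _ = ∫⁻ y, ∑ t ∈ I, (Metric.closedBall (X t) (κ * gap η a (X t))).indicator
        (fun _ => ENNReal.ofReal (gap η a (X t) / w t)) y ∂contextLaw 𝒳 f :=
        (lintegral_finsetSum _ fun t _ =>
          measurable_const.indicator Metric.isClosed_closedBall.measurableSet).symm
    _ ≤ ∫⁻ y, ENNReal.ofReal (k * (2 ^ (d - 1) / (V * κ ^ d))) *
          gapWeight η a (u / 2) y ∂contextLaw 𝒳 f := by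
        refine lintegral_mono_ae ?_
        filter_upwards [hp.ae_mem] with y hy
        obtain ⟨hcomp, hcard⟩ := card_filter_mem_ball_le hL hp.lipschitz hκ hκL
          (fun t ht => ⟨(hI t ht).1, (hI t ht).2.1, hpos t ht, (hI t ht).2.2.2⟩) hy
        set J := I.filter fun t => ‖y - X t‖ ≤ κ * gap η a (X t) with hJ
        have hsum : ∑ t ∈ I, (Metric.closedBall (X t) (κ * gap η a (X t))).indicator
            (fun _ => ENNReal.ofReal (gap η a (X t) / w t)) y =
              ∑ t ∈ J, ENNReal.ofReal (gap η a (X t) / w t) := by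
          rw [hJ, Finset.sum_filter]
          refine Finset.sum_congr rfl fun t _ => ?_
          by_cases h : ‖y - X t‖ ≤ κ * gap η a (X t) <;> simp [h, dist_eq_norm]
        rw [hsum]
        rcases J.eq_empty_or_nonempty with h0 | ⟨s, hs⟩
        · simp [h0]
        have hgy : u / 2 ≤ gap η a y := by
          obtain ⟨hsI, hsb⟩ := Finset.mem_filter.1 hs
          linarith [(hcomp s hsI hsb).1, (hI s hsI).2.2.1]
        have hgy0 : 0 < gap η a y := by linarith
        rw [gapWeight, if_pos hgy, ← ENNReal.ofReal_mul (by positivity)]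
        have hterm : ∀ t ∈ J, ENNReal.ofReal (gap η a (X t) / w t) ≤
            ENNReal.ofReal (2 ^ (d - 1) / (V * κ ^ d) * (1 / gap η a y ^ (d - 1))) := by
          intro t ht
          obtain ⟨htI, htb⟩ := Finset.mem_filter.1 ht
          refine ENNReal.ofReal_le_ofReal ?_
          rw [hwd t htI, show (2 : ℝ) ^ (d - 1) / (V * κ ^ d) * (1 / gap η a y ^ (d - 1)) =
            1 / (V * κ ^ d) * (1 / (gap η a y / 2) ^ (d - 1)) by rw [div_pow]; field_simp]
          gcongr
          linarith [(hcomp t htI htb).2]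
        refine (Finset.sum_le_card_nsmul _ _ _ hterm).trans ?_
        rw [nsmul_eq_mul, ← ENNReal.ofReal_natCast, ← ENNReal.ofReal_mul (by positivity)]
        refine ENNReal.ofReal_le_ofReal ?_
        rw [mul_assoc (k : ℝ)]
        gcongr
    _ = _ := lintegral_const_mul' _ _ ENNReal.ofReal_ne_top

end SumGap

/-! ### The margin condition on dyadic shells -/

section Margin

variable {d : ℕ} {𝒜 : Type*} {η : 𝒜 → Ctx d → ℝ}
  {𝒳 : Set (Ctx d)} {f : Ctx d → ℝ} {α Cα L c c₀ r₀ M : ℝ}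

/-- The contexts at which the gap of arm `a` is positive and less than `u`. -/
def smallGapSet (η : 𝒜 → Ctx d → ℝ) (a : 𝒜) (u : ℝ) : Set (Ctx d) :=
  {x | 0 < gap η a x ∧ gap η a x < u}

/-- Nothing is assumed about the rewards off `𝒳`, so the gap is measurable only up to null sets of
the context law. -/
lemma IsBanditProblem.aemeasurable_gap [Fintype 𝒜] [Nonempty 𝒜]
    (hp : IsBanditProblem α Cα L c c₀ r₀ M 𝒳 f η) (hL : 0 ≤ L) (a : 𝒜) :
    AEMeasurable (gap η a) (contextLaw 𝒳 f) :=
  ((continuousOn_gap hL hp.lipschitz a).aemeasurable hp.regular.measurableSet).mono_ac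
    (withDensity_absolutelyContinuous _ _)

lemma IsBanditProblem.nullMeasurableSet_smallGapSet [Fintype 𝒜] [Nonempty 𝒜]
    (hp : IsBanditProblem α Cα L c c₀ r₀ M 𝒳 f η) (hL : 0 ≤ L) (a : 𝒜) (u : ℝ) :
    NullMeasurableSet (smallGapSet η a u) (contextLaw 𝒳 f) := by
  have h : smallGapSet η a u = gap η a ⁻¹' Set.Ioo 0 u := by ext; exact Iff.rfl
  rw [h]
  exact (hp.aemeasurable_gap hL a).nullMeasurableSet_preimage measurableSet_Ioo

lemma IsBanditProblem.contextLaw_smallGapSet_le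
    (hp : IsBanditProblem α Cα L c c₀ r₀ M 𝒳 f η) (a : 𝒜) {u : ℝ} (hu : 0 < u) :
    contextLaw 𝒳 f (smallGapSet η a u) ≤ ENNReal.ofReal (max Cα 0 * u ^ α) := by
  refine (hp.margin a u hu).trans (ENNReal.ofReal_le_ofReal ?_)
  gcongr
  exact le_max_left _ _

lemma gapWeight_anti (η : 𝒜 → Ctx d → ℝ) (a : 𝒜) {ε ε' : ℝ} (h : ε ≤ ε') (y : Ctx d) :
    gapWeight η a ε' y ≤ gapWeight η a ε y := by
  unfold gapWeight
  split_ifs with h1 h2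
  · exact le_rfl
  · exact absurd (h.trans h1) h2
  · exact zero_le
  · exact le_rfl

/-- The gap lies in one dyadic shell below `|M| + 1`, and that term alone dominates. The added 1
makes the upper bound strict and positive. -/
lemma IsBanditProblem.gapWeight_le_sum
    (hp : IsBanditProblem α Cα L c c₀ r₀ M 𝒳 f η) (a : 𝒜) {ε : ℝ} (hε : 0 < ε) {n : ℕ}
    (hn : (|M| + 1) / 2 ^ n ≤ ε) {y : Ctx d} (hy : y ∈ 𝒳) :
    gapWeight η a ε y ≤ ∑ j ∈ Finset.range n, (smallGapSet η a ((|M| + 1) / 2 ^ j)).indicator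
      (fun _ => ENNReal.ofReal ((2 ^ (j + 1) / (|M| + 1)) ^ (d - 1))) y := by
  classical
  unfold gapWeight
  split_ifs with h
  swap; · exact zero_le
  have hg : 0 < gap η a y := hε.trans_le h
  have hM : 0 < |M| + 1 := by positivity
  have hgM : gap η a y < |M| + 1 := by linarith [hp.gap_le a y hy, le_abs_self M]
  have hex : ∃ i, (|M| + 1) / 2 ^ i ≤ gap η a y := ⟨n, hn.trans h⟩
  obtain ⟨j, hj⟩ : ∃ j, Nat.find hex = j + 1 := by
    refine Nat.exists_eq_succ_of_ne_zero fun h0 => ?_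
    have := Nat.find_spec hex
    rw [h0] at this
    simp at this
    linarith
  have h1 : (|M| + 1) / 2 ^ (j + 1) ≤ gap η a y := hj ▸ Nat.find_spec hex
  have h2 : gap η a y < (|M| + 1) / 2 ^ j := not_le.1 (Nat.find_min hex (by omega))
  have hjn : j ∈ Finset.range n := by
    have := Nat.find_min' hex (hn.trans h)
    rw [Finset.mem_range]; omega
  refine le_trans ?_ (Finset.single_le_sum (fun _ _ => zero_le) hjn)
  rw [Set.indicator_of_mem (show y ∈ smallGapSet η a ((|M| + 1) / 2 ^ j) from ⟨hg, h2⟩)]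
  refine ENNReal.ofReal_le_ofReal ?_
  rw [← one_div_pow]
  refine pow_le_pow_left₀ (by positivity) ?_ _
  rw [div_le_iff₀ (by positivity)] at h1
  rw [div_le_div_iff₀ hg hM]
  linarith

/-- A bound for the integral of `1 / gap^(d-1)` over the contexts with a gap of at least `ε`. -/
noncomputable def gapIntegralBound (d : ℕ) (α Cα M ε : ℝ) : ℝ :=
  if d = 1 then 1 else
    2 ^ (d - 1) * max Cα 0 * (|M| + 1) ^ (α - (d - 1 : ℕ)) *
      ∑ j ∈ Finset.range ⌈Real.logb 2 ((|M| + 1) / ε)⌉₊, ((2 : ℝ) ^ (((d - 1 : ℕ) : ℝ) - α)) ^ j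

lemma gapIntegralBound_nonneg (d : ℕ) (α Cα M ε : ℝ) : 0 ≤ gapIntegralBound d α Cα M ε := by
  unfold gapIntegralBound
  split_ifs
  · exact zero_le_one
  · have : 0 ≤ max Cα 0 := le_max_right _ _
    positivity

lemma IsBanditProblem.lintegral_gapWeight_le [Fintype 𝒜] [Nonempty 𝒜]
    [IsProbabilityMeasure (contextLaw 𝒳 f)]
    (hp : IsBanditProblem α Cα L c c₀ r₀ M 𝒳 f η) (hL : 0 ≤ L) (a : 𝒜) {ε : ℝ} (hε : 0 < ε) :
    ∫⁻ y, gapWeight η a ε y ∂contextLaw 𝒳 f ≤ ENNReal.ofReal (gapIntegralBound d α Cα M ε) := by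
  have hM : 0 < |M| + 1 := by positivity
  have hC : 0 ≤ max Cα 0 := le_max_right _ _
  unfold gapIntegralBound
  split_ifs with hd
  · calc ∫⁻ y, gapWeight η a ε y ∂contextLaw 𝒳 f ≤ ∫⁻ _, 1 ∂contextLaw 𝒳 f := by
          refine lintegral_mono fun y => ?_
          unfold gapWeight
          split_ifs <;> simp [hd]
      _ = _ := by simp
  set n := ⌈Real.logb 2 ((|M| + 1) / ε)⌉₊
  have hn : (|M| + 1) / 2 ^ n ≤ ε := by
    have h1 : (|M| + 1) / ε ≤ 2 ^ (n : ℝ) :=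
      (Real.logb_le_iff_le_rpow (by norm_num) (by positivity)).1 (Nat.le_ceil _)
    rw [Real.rpow_natCast] at h1
    rwa [div_le_iff₀ (by positivity), mul_comm, ← div_le_iff₀ hε]
  have hterm : ∀ j : ℕ, (2 ^ (j + 1) / (|M| + 1)) ^ (d - 1) *
      (max Cα 0 * ((|M| + 1) / 2 ^ j) ^ α) =
      2 ^ (d - 1) * max Cα 0 * (|M| + 1) ^ (α - (d - 1 : ℕ)) *
        ((2 : ℝ) ^ (((d - 1 : ℕ) : ℝ) - α)) ^ j := by
    intro j
    rw [Real.rpow_sub hM, Real.rpow_sub two_pos, Real.div_rpow hM.le (by positivity),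
      Real.rpow_natCast, Real.rpow_natCast, div_pow, div_pow, ← Real.rpow_natCast (2 ^ α),
      ← Real.rpow_mul two_pos.le, mul_comm α, Real.rpow_mul two_pos.le, Real.rpow_natCast, pow_succ,
      mul_pow, ← pow_mul, ← pow_mul, mul_comm j]
    field_simp
  calc ∫⁻ y, gapWeight η a ε y ∂contextLaw 𝒳 f
      ≤ ∫⁻ y, ∑ j ∈ Finset.range n, (smallGapSet η a ((|M| + 1) / 2 ^ j)).indicator
          (fun _ => ENNReal.ofReal ((2 ^ (j + 1) / (|M| + 1)) ^ (d - 1))) y ∂contextLaw 𝒳 f := by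
        refine lintegral_mono_ae ?_
        filter_upwards [hp.ae_mem] with y hy
        exact hp.gapWeight_le_sum a hε hn hy
    _ = ∑ j ∈ Finset.range n, ENNReal.ofReal ((2 ^ (j + 1) / (|M| + 1)) ^ (d - 1)) *
          contextLaw 𝒳 f (smallGapSet η a ((|M| + 1) / 2 ^ j)) := by
        rw [lintegral_finsetSum' _ fun j _ => (aemeasurable_const.indicator₀
          (hp.nullMeasurableSet_smallGapSet hL a _))]
        refine Finset.sum_congr rfl fun j _ => ?_
        rw [lintegral_indicator_const₀ (hp.nullMeasurableSet_smallGapSet hL a _)]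
    _ ≤ ∑ j ∈ Finset.range n, ENNReal.ofReal ((2 ^ (j + 1) / (|M| + 1)) ^ (d - 1)) *
          ENNReal.ofReal (max Cα 0 * ((|M| + 1) / 2 ^ j) ^ α) := by
        gcongr with j _
        exact hp.contextLaw_smallGapSet_le a (by positivity)
    _ = _ := by
        rw [Finset.mul_sum, ENNReal.ofReal_sum_of_nonneg fun j _ => by positivity]
        refine Finset.sum_congr rfl fun j _ => ?_
        rw [← ENNReal.ofReal_mul (by positivity), hterm]

end Margin

/-! ### Regret of a trajectory with good noise -/

section PathwiseRegret

variable {d : ℕ} {𝒜 : Type*} [Fintype 𝒜] [Nonempty 𝒜] [DecidableEq 𝒜] {η : 𝒜 → Ctx d → ℝ}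
  {𝒳 : Set (Ctx d)} {f : Ctx d → ℝ} {α Cα σ L c c₀ r₀ M : ℝ} {X : ℕ → Ctx d} {W : ℕ → ℝ}
  {A : ℕ → 𝒜} {T k : ℕ}

omit [Fintype 𝒜] [Nonempty 𝒜] in
-- At the last such pull all the others are earlier pulls of `a`, and there are fewer than `k` of
-- those.
lemma card_filter_pulls_lt_le (A : ℕ → 𝒜) (T k : ℕ) (a : 𝒜) :
    ((Finset.range T).filter fun t => A t = a ∧ (pulls A t a).card < k).card ≤ k := by
  set J := (Finset.range T).filter fun t => A t = a ∧ (pulls A t a).card < k with hJ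
  rcases J.eq_empty_or_nonempty with h0 | hne
  · simp [h0]
  have ht := (Finset.mem_filter.1 (J.max'_mem hne)).2.2
  have hsub : J.erase (J.max' hne) ⊆ pulls A (J.max' hne) a := by
    intro s hs
    obtain ⟨hst, hsJ⟩ := Finset.mem_erase.1 hs
    exact Finset.mem_filter.2 ⟨Finset.mem_range.2 (lt_of_le_of_ne (J.le_max' s hsJ) hst),
      (Finset.mem_filter.1 hsJ).2.1⟩
  have := Finset.card_le_card hsub
  rw [Finset.card_erase_of_mem (J.max'_mem hne)] at this
  omega

/-- The regret of a trajectory along which the noise averages are at most the bonus. -/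
lemma IsBanditProblem.sum_range_gap_le (hp : IsBanditProblem α Cα L c c₀ r₀ M 𝒳 f η) (hd : 1 ≤ d)
    (hL : 0 ≤ L) (hc : 0 < c) (hc₀ : 0 < c₀) {κ : ℝ} (hκ : 0 < κ)
    (hκL : 32 * (L + 1) * κ ≤ 1) (hκr : κ * (|M| + 1) ≤ r₀) {u : ℝ} (hu : 0 < u) (hk : 1 ≤ k)
    (hub : 4 * bonus d T (Fintype.card 𝒜) k σ ≤ u)
    (hX : ∀ t < T, X t ∈ 𝒳)
    (hsel : ∀ t < T, SelectsUCB σ L T k X (fun i => η (A i) (X i) + W i) A t)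
    (hW : ∀ t < T, ∀ a N, IsKNearest X k (X t) (pulls A t a) N →
      |∑ i ∈ N, W i| ≤ k * bonus d T (Fintype.card 𝒜) k σ) {J : ENNReal}
    (hJ : ∀ a, ∫⁻ y, gapWeight η a (u / 2) y ∂contextLaw 𝒳 f ≤ J) :
    ∑ t ∈ Finset.range T, ENNReal.ofReal (gap η (A t) (X t)) ≤
      Fintype.card 𝒜 * (k * ENNReal.ofReal (|M| + 1)) +
      (∑ t ∈ Finset.range T, ∑ a, (smallGapSet η a u).indicator
        (fun _ => ENNReal.ofReal u) (X t)) +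
      Fintype.card 𝒜 *
        (ENNReal.ofReal (k * (2 ^ (d - 1) / (c * c₀ * unitBallVolume d * κ ^ d))) * J) := by
  have harm : ∀ a, ∑ t ∈ (Finset.range T).filter (fun t => A t = a),
      ENNReal.ofReal (gap η a (X t)) ≤ k * ENNReal.ofReal (|M| + 1) +
        (∑ t ∈ Finset.range T, (smallGapSet η a u).indicator (fun _ => ENNReal.ofReal u) (X t)) +
        ENNReal.ofReal (k * (2 ^ (d - 1) / (c * c₀ * unitBallVolume d * κ ^ d))) * J := by
    intro a
    -- The pulls of `a` are split into the first `k`, those with gap below `u`, and those with gap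
    -- at least `u`.
    rw [← Finset.sum_filter_add_sum_filter_not _ (fun t => (pulls A t a).card < k),
      ← Finset.sum_filter_add_sum_filter_not
        (((Finset.range T).filter fun t => A t = a).filter fun t => ¬ (pulls A t a).card < k)
        (fun t => gap η a (X t) < u), ← add_assoc]
    gcongr ?_ + ?_ + ?_
    · refine (Finset.sum_le_card_nsmul _ _ (ENNReal.ofReal (|M| + 1)) fun t ht => ?_).trans ?_
      · have htT := Finset.mem_range.1 (Finset.mem_filter.1 (Finset.mem_filter.1 ht).1).1
        exact ENNReal.ofReal_le_ofReal (by linarith [hp.gap_le a _ (hX t htT), le_abs_self M])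
      · rw [nsmul_eq_mul, Finset.filter_filter]
        gcongr
        exact card_filter_pulls_lt_le A T k a
    · refine (Finset.sum_le_sum fun t ht => ?_).trans (Finset.sum_le_sum_of_subset
        (f := fun t => (smallGapSet η a u).indicator (fun _ => ENNReal.ofReal u) (X t))
        ((Finset.filter_subset _ _).trans ((Finset.filter_subset _ _).trans
          (Finset.filter_subset _ _))))
      have hlt := (Finset.mem_filter.1 ht).2
      -- Zero gaps, about which the margin condition is silent, contribute nothing.
      rcases (gap_nonneg η a (X t)).eq_or_lt with h0 | h0
      · rw [← h0]; simp
      · rw [Set.indicator_of_mem (show X t ∈ smallGapSet η a u from ⟨h0, hlt⟩)]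
        exact ENNReal.ofReal_le_ofReal hlt.le
    · refine (hp.sum_gap_le (A := A) (k := k) hd hL hc hc₀ hκ hκL hκr hu fun t ht => ?_).trans ?_
      · simp only [Finset.mem_filter, Finset.mem_range, not_lt] at ht
        obtain ⟨⟨⟨htT, rfl⟩, hcard⟩, hgu⟩ := ht
        exact ⟨rfl, hX t htT, hgu, card_close_pulls_lt hL hp.lipschitz
          (fun i hi => hX i (hi.trans_lt htT)) hk (hsel t htT) (hW t htT) hcard (hub.trans hgu)⟩
      · gcongr
        exact hJ a
  calc ∑ t ∈ Finset.range T, ENNReal.ofReal (gap η (A t) (X t))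
      = ∑ a, ∑ t ∈ (Finset.range T).filter (fun t => A t = a),
          ENNReal.ofReal (gap η a (X t)) := by
        rw [← Finset.sum_fiberwise (Finset.range T) A]
        refine Finset.sum_congr rfl fun a _ => Finset.sum_congr rfl fun t ht => ?_
        rw [(Finset.mem_filter.1 ht).2]
    _ ≤ ∑ a, _ := Finset.sum_le_sum fun a _ => harm a
    _ = _ := by
        rw [Finset.sum_add_distrib, Finset.sum_add_distrib, Finset.sum_comm]
        simp

end PathwiseRegret

/-! ### Growth of the dyadic sum in the horizon -/

section Growth

/-- Lets terms without a logarithm be absorbed into the final bound. -/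
lemma one_le_log_rpow {l e : ℝ} (he : 0 ≤ e) (hl : Real.log 2 ≤ l) :
    1 ≤ (Real.log 2 ^ e)⁻¹ * l ^ e := by
  have h2 : 0 < Real.log 2 := Real.log_pos one_lt_two
  rw [inv_mul_eq_div, one_le_div (by positivity)]
  exact Real.rpow_le_rpow h2.le hl he

lemma le_log_rpow {l e : ℝ} (he : 1 ≤ e) (hl : Real.log 2 ≤ l) :
    l ≤ (Real.log 2 ^ (e - 1))⁻¹ * l ^ e := by
  have h2 : 0 < Real.log 2 := Real.log_pos one_lt_two
  have hl0 : 0 < l := h2.trans_le hl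
  have h := one_le_log_rpow (sub_nonneg.2 he) hl
  calc l = 1 * l := (one_mul l).symm
    _ ≤ ((Real.log 2 ^ (e - 1))⁻¹ * l ^ (e - 1)) * l := by gcongr
    _ = _ := by rw [Real.rpow_sub_one hl0.ne' e]; field_simp

lemma two_pow_ceil_logb_le {Q : ℝ} (hQ : 1 ≤ Q) : (2 : ℝ) ^ ⌈Real.logb 2 Q⌉₊ ≤ 2 * Q := by
  have h0 : 0 ≤ Real.logb 2 Q := Real.logb_nonneg one_lt_two hQ
  rw [← Real.rpow_natCast]
  calc (2 : ℝ) ^ (⌈Real.logb 2 Q⌉₊ : ℝ) ≤ 2 ^ (Real.logb 2 Q + 1) :=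
        Real.rpow_le_rpow_of_exponent_le one_le_two (Nat.ceil_lt_add_one h0).le
    _ = 2 * Q := by
        rw [Real.rpow_add two_pos, Real.rpow_logb two_pos (by norm_num) (by linarith),
          Real.rpow_one, mul_comm]

/-- The dyadic sum behind `gapIntegralBound`, with `e = d - 1 - α`. -/
lemma exists_geom_sum_le {α e M p q : ℝ} (hp : 0 ≤ p) (hpq : p ≤ q) (hα : 0 ≤ α)
    (he : 0 < e → p + p * e / 2 ≤ q) (hα1 : e = 0 → 1 ≤ α) :
    ∃ D : ℝ, 0 ≤ D ∧ ∀ T l : ℝ, 1 ≤ T → Real.log 2 ≤ l → Real.log T ≤ l →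
      T ^ p * ∑ j ∈ Finset.range ⌈Real.logb 2 ((|M| + 1) / (T ^ (-(p / 2)) / 4))⌉₊,
        ((2 : ℝ) ^ e) ^ j ≤ D * T ^ q * l ^ ((α + 1) / 2) := by
  have h2 : 0 < Real.log 2 := Real.log_pos one_lt_two
  have hM : 1 ≤ |M| + 1 := by linarith [abs_nonneg M]
  have hQ : ∀ T : ℝ, 1 ≤ T →
      (|M| + 1) / (T ^ (-(p / 2)) / 4) = 4 * (|M| + 1) * T ^ (p / 2) := by
    intro T hT
    rw [Real.rpow_neg (by linarith)]
    field_simp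
  have hQ1 : ∀ T : ℝ, 1 ≤ T → 1 ≤ 4 * (|M| + 1) * T ^ (p / 2) := by
    intro T hT
    have : 1 ≤ T ^ (p / 2) := Real.one_le_rpow hT (by positivity)
    nlinarith
  set E := (α + 1) / 2 with hE
  have hE0 : 0 ≤ E := by positivity
  have hbdd : ∀ K : ℝ, 0 ≤ K → ∀ T l : ℝ, 1 ≤ T → Real.log 2 ≤ l →
      T ^ q * K ≤ K * (Real.log 2 ^ E)⁻¹ * T ^ q * l ^ E := by
    intro K hK T l hT hl
    have := one_le_log_rpow hE0 hl
    calc T ^ q * K = K * T ^ q * 1 := by ring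
      _ ≤ K * T ^ q * ((Real.log 2 ^ E)⁻¹ * l ^ E) := by gcongr
      _ = _ := by ring
  rcases lt_trichotomy e 0 with he0 | rfl | he0
  -- Convergent geometric series: the sum is bounded uniformly in `T`.
  · have hθ : (2 : ℝ) ^ e < 1 := Real.rpow_lt_one_of_one_lt_of_neg one_lt_two he0
    have hθ0 : (0 : ℝ) ≤ 2 ^ e := by positivity
    have hK : 0 ≤ (1 - (2 : ℝ) ^ e)⁻¹ := inv_nonneg.2 (by linarith)
    refine ⟨(1 - (2 : ℝ) ^ e)⁻¹ * (Real.log 2 ^ E)⁻¹, by positivity, fun T l hT hl hTl => ?_⟩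
    refine le_trans ?_ (hbdd _ hK T l hT hl)
    gcongr
    · rw [← tsum_geometric_of_lt_one hθ0 hθ]
      exact (summable_geometric_of_lt_one hθ0 hθ).sum_le_tsum _ fun _ _ => by positivity
  -- All terms equal 1 and their number is of order `log T`; `α ≥ 1` makes the exponent of the
  -- logarithm large enough to absorb it.
  · have hE1 : 1 ≤ E := by have := hα1 rfl; rw [hE]; linarith
    set c := Real.logb 2 (4 * (|M| + 1)) + 1 with hc
    have hc0 : 0 ≤ c := by
      have : 0 ≤ Real.logb 2 (4 * (|M| + 1)) := Real.logb_nonneg one_lt_two (by linarith)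
      linarith
    refine ⟨(c / Real.log 2 + p / 2 / Real.log 2) * (Real.log 2 ^ (E - 1))⁻¹, by positivity,
      fun T l hT hl hTl => ?_⟩
    have hT0 : 0 < T := by linarith
    have hn : (⌈Real.logb 2 (4 * (|M| + 1) * T ^ (p / 2))⌉₊ : ℝ) ≤
        (c / Real.log 2 + p / 2 / Real.log 2) * l := by
      refine (Nat.ceil_lt_add_one (Real.logb_nonneg one_lt_two (hQ1 T hT))).le.trans ?_
      rw [Real.logb_mul (by positivity) (by positivity), Real.logb_rpow_eq_mul_logb_of_pos hT0]
      have h3 : p / 2 * Real.logb 2 T ≤ p / 2 / Real.log 2 * l := by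
        rw [Real.logb, ← mul_div_assoc, mul_div_right_comm]
        gcongr
      have h4 : c ≤ c / Real.log 2 * l := by
        rw [div_mul_eq_mul_div, le_div_iff₀ h2]
        gcongr
      linarith
    rw [hQ T hT]
    simp only [Real.rpow_zero, one_pow, Finset.sum_const, Finset.card_range, nsmul_eq_mul, mul_one]
    calc T ^ p * (⌈Real.logb 2 (4 * (|M| + 1) * T ^ (p / 2))⌉₊ : ℝ)
        ≤ T ^ q * ((c / Real.log 2 + p / 2 / Real.log 2) *
          ((Real.log 2 ^ (E - 1))⁻¹ * l ^ E)) := by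
          gcongr
          exact hn.trans (by gcongr; exact le_log_rpow hE1 hl)
      _ = _ := by ring
  -- The last scale dominates and contributes the power `T^(p e / 2)`.
  · have hθ : 1 < (2 : ℝ) ^ e := Real.one_lt_rpow one_lt_two he0
    have hθ1 : 0 < (2 : ℝ) ^ e - 1 := by linarith
    set K : ℝ := (2 * (4 * (|M| + 1))) ^ e / ((2 : ℝ) ^ e - 1) with hKdef
    have hK : 0 ≤ K := by positivity
    refine ⟨K * (Real.log 2 ^ E)⁻¹, by positivity, fun T l hT hl hTl => ?_⟩
    refine le_trans ?_ (hbdd _ hK T l hT hl)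
    have hT0 : 0 < T := by linarith
    rw [hQ T hT]
    set n := ⌈Real.logb 2 (4 * (|M| + 1) * T ^ (p / 2))⌉₊ with hn
    have h3 : ((2 : ℝ) ^ e) ^ n ≤ (2 * (4 * (|M| + 1))) ^ e * T ^ (p * e / 2) := by
      rw [← Real.rpow_natCast, ← Real.rpow_mul two_pos.le, mul_comm e, Real.rpow_mul two_pos.le,
        Real.rpow_natCast]
      calc ((2 : ℝ) ^ n) ^ e ≤ (2 * (4 * (|M| + 1) * T ^ (p / 2))) ^ e :=
            Real.rpow_le_rpow (by positivity) (two_pow_ceil_logb_le (hQ1 T hT)) he0.le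
        _ = _ := by
            rw [← mul_assoc, Real.mul_rpow (by positivity) (by positivity),
              ← Real.rpow_mul hT0.le]
            congr 2; ring
    have h4 : ∑ j ∈ Finset.range n, ((2 : ℝ) ^ e) ^ j ≤ K * T ^ (p * e / 2) := by
      rw [geom_sum_eq hθ.ne', hKdef, div_mul_eq_mul_div]
      gcongr
      linarith
    calc T ^ p * ∑ j ∈ Finset.range n, ((2 : ℝ) ^ e) ^ j ≤ T ^ p * (K * T ^ (p * e / 2)) := by
          gcongr
      _ = T ^ (p + p * e / 2) * K := by rw [Real.rpow_add hT0]; ring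
      _ ≤ T ^ q * K := by
          gcongr
          exact he he0

lemma exists_gapIntegralBound_le {d : ℕ} (hd : 1 ≤ d) (Cα M : ℝ) {α p q : ℝ} (hp : 0 ≤ p)
    (hpq : p ≤ q) (hα : 0 ≤ α) (he : α < d - 1 → p + p * (d - 1 - α) / 2 ≤ q) :
    ∃ D : ℝ, 0 ≤ D ∧ ∀ T l : ℝ, 1 ≤ T → Real.log 2 ≤ l → Real.log T ≤ l →
      T ^ p * gapIntegralBound d α Cα M (T ^ (-(p / 2)) / 4) ≤
        D * T ^ q * l ^ ((α + 1) / 2) := by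
  have h2 : 0 < Real.log 2 := Real.log_pos one_lt_two
  unfold gapIntegralBound
  -- In dimension one the integrand is at most 1. The dyadic sum would lose a full logarithm at `α =
  -- 0`, where only its square root is available.
  split_ifs with hd1
  · refine ⟨(Real.log 2 ^ ((α + 1) / 2))⁻¹, by positivity, fun T l hT hl _ => ?_⟩
    have := one_le_log_rpow (e := (α + 1) / 2) (by positivity) hl
    calc T ^ p * 1 ≤ T ^ q * ((Real.log 2 ^ ((α + 1) / 2))⁻¹ * l ^ ((α + 1) / 2)) := by
          gcongr
      _ = _ := by ring
  have hcast : ((d - 1 : ℕ) : ℝ) = d - 1 := by push_cast [hd]; ring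
  have hd2 : (2 : ℝ) ≤ d := by exact_mod_cast (by omega : 2 ≤ d)
  obtain ⟨D, hD, h⟩ := exists_geom_sum_le (M := M) (e := ((d - 1 : ℕ) : ℝ) - α) hp hpq hα
    (by rw [hcast]; intro h; exact he (by linarith))
    (by rw [hcast]; intro h; linarith)
  have hC : 0 ≤ max Cα 0 := le_max_right _ _
  set K := 2 ^ (d - 1) * max Cα 0 * (|M| + 1) ^ (α - (d - 1 : ℕ)) with hK
  have hK0 : 0 ≤ K := by positivity
  refine ⟨K * D, by positivity, fun T l hT hl hTl => ?_⟩
  calc _ = K * (T ^ p * ∑ j ∈ Finset.range ⌈Real.logb 2 ((|M| + 1) / (T ^ (-(p / 2)) / 4))⌉₊,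
        ((2 : ℝ) ^ (((d - 1 : ℕ) : ℝ) - α)) ^ j) := by ring
    _ ≤ K * (D * T ^ q * l ^ ((α + 1) / 2)) := mul_le_mul_of_nonneg_left (h T l hT hl hTl) hK0
    _ = _ := by ring

end Growth

/-! ### Expected regret at a general threshold -/

section PathRegret

variable {d : ℕ} {𝒜 : Type*} [Fintype 𝒜] {η : 𝒜 → Ctx d → ℝ} {𝒳 : Set (Ctx d)} {f : Ctx d → ℝ}
  {α Cα L c c₀ r₀ M : ℝ} {Ω : Type*} {X : ℕ → Ω → Ctx d} {A : ℕ → Ω → 𝒜} {T : ℕ}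

lemma pathRegret_nonneg (ω : Ω) : 0 ≤ pathRegret η T X A ω :=
  Finset.sum_nonneg fun _ _ => gap_nonneg _ _ _

omit [Fintype 𝒜] in
lemma IsBanditProblem.pathRegret_le (hp : IsBanditProblem α Cα L c c₀ r₀ M 𝒳 f η) {ω : Ω}
    (hX : ∀ t < T, X t ω ∈ 𝒳) : pathRegret η T X A ω ≤ T * (|M| + 1) := by
  refine (Finset.sum_le_card_nsmul _ _ (|M| + 1) fun t ht => ?_).trans (by simp [mul_add])
  linarith [hp.gap_le (A t ω) _ (hX t (Finset.mem_range.1 ht)), le_abs_self M]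

lemma pathRegret_eq_zero [Nonempty 𝒜] (h : Fintype.card 𝒜 = 1) : pathRegret η T X A = 0 := by
  ext ω
  refine Finset.sum_eq_zero fun t _ => ?_
  obtain ⟨a, ha⟩ := exists_eq_bestReward η (X t ω)
  have : Subsingleton 𝒜 := Fintype.card_le_one_iff_subsingleton.1 h.le
  rw [gap, ← ha, Subsingleton.elim a (A t ω), sub_self]

end PathRegret

section Regret

variable {d : ℕ} {𝒜 : Type*} [Fintype 𝒜] [Nonempty 𝒜] [MeasurableSpace 𝒜]
  [MeasurableSingletonClass 𝒜] {η : 𝒜 → Ctx d → ℝ}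
  {𝒳 : Set (Ctx d)} {f : Ctx d → ℝ} {α Cα σ L c c₀ r₀ M : ℝ}
  {Ω : Type*} [MeasurableSpace Ω] {P : Measure Ω} [IsProbabilityMeasure P]
  {X : ℕ → Ω → Ctx d} {W : ℕ → Ω → ℝ} {A : ℕ → Ω → 𝒜} {T k : ℕ}

omit [Fintype 𝒜] [Nonempty 𝒜] [MeasurableSingletonClass 𝒜] [IsProbabilityMeasure P] in
lemma IsInteraction.ae_mem (hI : IsInteraction P (contextLaw 𝒳 f) σ T X W A)
    (hp : IsBanditProblem α Cα L c c₀ r₀ M 𝒳 f η) : ∀ᵐ ω ∂P, ∀ t < T, X t ω ∈ 𝒳 := by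
  refine ae_all_iff.2 fun t => ae_all_iff.2 fun ht => ?_
  refine ae_of_ae_map (hI.measurable_context t ht).aemeasurable ?_
  rw [hI.context_law t ht]
  exact hp.ae_mem

lemma IsInteraction.integrable_pathRegret
    (hI : IsInteraction P (contextLaw 𝒳 f) σ T X W A)
    (hp : IsBanditProblem α Cα L c c₀ r₀ M 𝒳 f η) (hL : 0 ≤ L) :
    Integrable (pathRegret η T X A) P := by
  classical
  have hm : AEMeasurable (pathRegret η T X A) P := by
    refine Finset.aemeasurable_fun_sum _ fun t ht => ?_
    have htT := Finset.mem_range.1 ht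
    have h : (fun ω => gap η (A t ω) (X t ω)) =
        fun ω => ∑ a, (A t ⁻¹' {a}).indicator (fun ω => gap η a (X t ω)) ω := by
      ext ω
      simp [Set.indicator_apply]
    rw [h]
    refine Finset.aemeasurable_fun_sum _ fun a _ => AEMeasurable.indicator ?_
      (hI.measurable_arm t htT (measurableSet_singleton a))
    have := hp.aemeasurable_gap hL a
    rw [← hI.context_law t htT] at this
    exact this.comp_measurable (hI.measurable_context t htT)
  refine Integrable.of_bound hm.aestronglyMeasurable (T * (|M| + 1)) ?_
  filter_upwards [hI.ae_mem hp] with ω hω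
  rw [Real.norm_eq_abs, abs_of_nonneg (pathRegret_nonneg ω)]
  exact hp.pathRegret_le hω

variable [DecidableEq 𝒜]

/-- The expected regret in terms of the threshold `u` that separates small and large gaps. -/
lemma IsInteraction.lintegral_pathRegret_le
    (hI : IsInteraction P (contextLaw 𝒳 f) σ T X W A)
    (hp : IsBanditProblem α Cα L c c₀ r₀ M 𝒳 f η)
    (hA : FollowsKNNUCB P η σ L T k X W A) (hσ : 0 ≤ σ) (hd : 1 ≤ d)
    (hL : 0 ≤ L) (hc : 0 < c) (hc₀ : 0 < c₀) {κ : ℝ} (hκ : 0 < κ)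
    (hκL : 32 * (L + 1) * κ ≤ 1) (hκr : κ * (|M| + 1) ≤ r₀) {u : ℝ} (hu : 0 < u) (hk : 1 ≤ k)
    (hT : 1 ≤ T) (hub : 4 * bonus d T (Fintype.card 𝒜) k σ ≤ u) {ε : ℝ} (hε : 0 < ε)
    (hεu : ε ≤ u / 2) :
    ∫⁻ ω, ENNReal.ofReal (pathRegret η T X A ω) ∂P ≤ ENNReal.ofReal (2 * (|M| + 1) +
      Fintype.card 𝒜 * (k * (|M| + 1)) + T * (Fintype.card 𝒜 * (u * (max Cα 0 * u ^ α))) +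
      Fintype.card 𝒜 * ((k * (2 ^ (d - 1) / (c * c₀ * unitBallVolume d * κ ^ d))) *
        gapIntegralBound d α Cα M ε)) := by
  have hT0 : (0 : ℝ) < T := by exact_mod_cast hT
  have hM : 0 < |M| + 1 := by positivity
  have hC : 0 ≤ max Cα 0 := le_max_right _ _
  have hV := unitBallVolume_pos d
  have hG := gapIntegralBound_nonneg d α Cα M ε
  have : IsProbabilityMeasure (contextLaw 𝒳 f) := by
    rw [← hI.context_law 0 hT]
    exact Measure.isProbabilityMeasure_map (hI.measurable_context 0 hT).aemeasurable
  obtain ⟨B, hBm, hPB, hB⟩ := hI.exists_deviation_event hσ hd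
    (contextLaw_absolutelyContinuous 𝒳 f) hT hk
  have hsel : ∀ᵐ ω ∂P, ∀ t < T, SelectsUCB σ L T k (fun i => X i ω)
      (fun i => reward η X W A i ω) (fun i => A i ω) t :=
    ae_all_iff.2 fun t => ae_all_iff.2 fun ht => hA t ht
  set J := ENNReal.ofReal (gapIntegralBound d α Cα M ε) with hJdef
  have hJ : ∀ a, ∫⁻ y, gapWeight η a (u / 2) y ∂contextLaw 𝒳 f ≤ J := fun a =>
    (lintegral_mono fun y => gapWeight_anti η a hεu y).trans (hp.lintegral_gapWeight_le hL a hε)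
  set C₁ := (k : ℝ) * (2 ^ (d - 1) / (c * c₀ * unitBallVolume d * κ ^ d)) with hC₁
  have hpath : ∀ᵐ ω ∂P, ENNReal.ofReal (pathRegret η T X A ω) ≤
      B.indicator (fun _ => ENNReal.ofReal (T * (|M| + 1))) ω +
      (Fintype.card 𝒜 * (k * ENNReal.ofReal (|M| + 1)) +
      (∑ t ∈ Finset.range T, ∑ a, (smallGapSet η a u).indicator
        (fun _ => ENNReal.ofReal u) (X t ω)) +
      Fintype.card 𝒜 * (ENNReal.ofReal C₁ * J)) := by
    filter_upwards [hI.ae_mem hp, hB, hsel] with ω hX hW hs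
    by_cases hω : ω ∈ B
    · rw [Set.indicator_of_mem hω]
      exact le_add_right (ENNReal.ofReal_le_ofReal (hp.pathRegret_le hX))
    · rw [Set.indicator_of_notMem hω, zero_add, pathRegret,
        ENNReal.ofReal_sum_of_nonneg fun _ _ => gap_nonneg _ _ _]
      exact hp.sum_range_gap_le hd hL hc hc₀ hκ hκL hκr hu hk hub hX hs (hW hω) hJ
  have hsmall_meas : ∀ t < T, ∀ a, AEMeasurable (fun ω => (smallGapSet η a u).indicator
      (fun _ => ENNReal.ofReal u) (X t ω)) P := by
    intro t ht a
    have h := (aemeasurable_const (b := ENNReal.ofReal u)).indicator₀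
      (hp.nullMeasurableSet_smallGapSet hL a u)
    rw [← hI.context_law t ht] at h
    exact h.comp_measurable (hI.measurable_context t ht)
  have hsmall : ∀ t < T, ∀ a, ∫⁻ ω, (smallGapSet η a u).indicator
      (fun _ => ENNReal.ofReal u) (X t ω) ∂P ≤ ENNReal.ofReal (u * (max Cα 0 * u ^ α)) := by
    intro t ht a
    have h := (aemeasurable_const (b := ENNReal.ofReal u)).indicator₀
      (hp.nullMeasurableSet_smallGapSet hL a u)
    rw [← hI.context_law t ht] at h
    rw [← lintegral_map' h (hI.measurable_context t ht).aemeasurable, hI.context_law t ht,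
      ENNReal.ofReal_mul hu.le]
    refine (lintegral_indicator_const_le _ _).trans ?_
    gcongr
    exact hp.contextLaw_smallGapSet_le a hu
  calc ∫⁻ ω, ENNReal.ofReal (pathRegret η T X A ω) ∂P
      ≤ ∫⁻ ω, B.indicator (fun _ => ENNReal.ofReal (T * (|M| + 1))) ω +
      (Fintype.card 𝒜 * (k * ENNReal.ofReal (|M| + 1)) +
      (∑ t ∈ Finset.range T, ∑ a, (smallGapSet η a u).indicator
        (fun _ => ENNReal.ofReal u) (X t ω)) +
      Fintype.card 𝒜 * (ENNReal.ofReal C₁ * J)) ∂P := lintegral_mono_ae hpath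
    _ = ENNReal.ofReal (T * (|M| + 1)) * P B + (Fintype.card 𝒜 * (k * ENNReal.ofReal (|M| + 1)) +
      (∑ t ∈ Finset.range T, ∑ a, ∫⁻ ω, (smallGapSet η a u).indicator
        (fun _ => ENNReal.ofReal u) (X t ω) ∂P) +
      Fintype.card 𝒜 * (ENNReal.ofReal C₁ * J)) := by
        rw [lintegral_add_left (measurable_const.indicator hBm), lintegral_indicator_const hBm,
          lintegral_add_right _ measurable_const, lintegral_add_left measurable_const,
          lintegral_finsetSum' _ fun t ht => Finset.aemeasurable_fun_sum _ fun a _ =>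
            hsmall_meas t (Finset.mem_range.1 ht) a,
          lintegral_const, lintegral_const, measure_univ, mul_one, mul_one]
        congr 3
        refine Finset.sum_congr rfl fun t ht => ?_
        exact lintegral_finsetSum' _ fun a _ => hsmall_meas t (Finset.mem_range.1 ht) a
    _ ≤ ENNReal.ofReal (T * (|M| + 1)) * ENNReal.ofReal (2 / T) +
      (Fintype.card 𝒜 * (k * ENNReal.ofReal (|M| + 1)) +
      (∑ t ∈ Finset.range T, ∑ _a : 𝒜, ENNReal.ofReal (u * (max Cα 0 * u ^ α))) +
      Fintype.card 𝒜 * (ENNReal.ofReal C₁ * J)) := by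
        gcongr with t ht a _
        exact hsmall t (Finset.mem_range.1 ht) a
    _ = _ := by
        have hC₁0 : 0 ≤ C₁ := by positivity
        have hu' : 0 ≤ u * (max Cα 0 * u ^ α) := by positivity
        -- The bad event: regret at most `T (|M| + 1)` with probability at most `2 / T`.
        have h2 : (T : ℝ) * (|M| + 1) * (2 / T) = 2 * (|M| + 1) := by field_simp
        simp only [Finset.sum_const, Finset.card_range, Finset.card_univ, nsmul_eq_mul]
        generalize u * (max Cα 0 * u ^ α) = y at hu' ⊢
        generalize |M| + 1 = x at hM h2 ⊢
        rw [hJdef, ← ENNReal.ofReal_natCast T, ← ENNReal.ofReal_natCast k,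
          ← ENNReal.ofReal_natCast (Fintype.card 𝒜), ← ENNReal.ofReal_mul (by positivity),
          ← ENNReal.ofReal_mul (by positivity), ← ENNReal.ofReal_mul (by positivity),
          ← ENNReal.ofReal_mul (by positivity), ← ENNReal.ofReal_mul (by positivity),
          ← ENNReal.ofReal_mul (by positivity), ← ENNReal.ofReal_mul (by positivity),
          ← ENNReal.ofReal_add (by positivity) (by positivity),
          ← ENNReal.ofReal_add (by positivity) (by positivity),
          ← ENNReal.ofReal_add (by positivity) (by positivity), h2]
        congr 1
        ring

end Regret

/-! ### Choice of parameters and the two rates -/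

lemma log_logArg_ge {d T m : ℕ} (hd : 1 ≤ d) (hT : 1 ≤ T) (hm : 2 ≤ m) :
    Real.log 2 ≤ Real.log (logArg d T m) ∧ Real.log T ≤ Real.log (logArg d T m) := by
  have hT0 : (0 : ℝ) < T := by exact_mod_cast hT
  have h1 : T * 2 ≤ d * T ^ (2 * d + 2) * m := by
    calc T * 2 = 1 * T ^ 1 * 2 := by ring
      _ ≤ d * T ^ (2 * d + 2) * m := by gcongr; omega
  have h2 : (T : ℝ) * 2 ≤ logArg d T m := by unfold logArg; exact_mod_cast h1
  have hT1 : (1 : ℝ) ≤ T := by exact_mod_cast hT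
  exact ⟨Real.log_le_log two_pos (by linarith), Real.log_le_log hT0 (by linarith)⟩

/-- The threshold between small and large gaps dominates the bonus. -/
lemma four_mul_bonus_le {d T m k : ℕ} {σ κ₁ p : ℝ} (hκ₁ : 0 < κ₁) (hT : 1 ≤ T)
    (hk : κ₁ * (T : ℝ) ^ p ≤ k) (hl : 0 ≤ Real.log (logArg d T m)) :
    4 * bonus d T m k σ ≤ (1 + 4 * Real.sqrt (2 * σ ^ 2 / κ₁)) *
      (Real.log (logArg d T m) ^ ((1 : ℝ) / 2) * (T : ℝ) ^ (-(p / 2))) := by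
  have hT0 : (0 : ℝ) < T := by exact_mod_cast hT
  have h : bonus d T m k σ ≤ Real.sqrt (2 * σ ^ 2 / κ₁) *
      (Real.log (logArg d T m) ^ ((1 : ℝ) / 2) * (T : ℝ) ^ (-(p / 2))) := by
    have hT' : (T : ℝ) ^ (-(p / 2)) = Real.sqrt ((T : ℝ) ^ (-p)) := by
      rw [Real.sqrt_eq_rpow, ← Real.rpow_mul hT0.le]
      congr 1; ring
    rw [hT', ← Real.sqrt_eq_rpow, ← Real.sqrt_mul hl, ← Real.sqrt_mul (by positivity), bonus]
    refine Real.sqrt_le_sqrt ?_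
    calc 2 * σ ^ 2 / k * Real.log (logArg d T m)
        ≤ 2 * σ ^ 2 / (κ₁ * (T : ℝ) ^ p) * Real.log (logArg d T m) := by gcongr
      _ = _ := by rw [Real.rpow_neg hT0.le]; field_simp
  have h0 : 0 ≤ Real.log (logArg d T m) ^ ((1 : ℝ) / 2) * (T : ℝ) ^ (-(p / 2)) := by positivity
  linarith

/-- The conditions on `p` and `q` match the sources of regret: `hpq` the first `k` pulls, `hq` the
small gaps, `he` the large gaps when the dyadic sum diverges. -/
theorem regretBound_of_exponents {d : ℕ} (hd : 1 ≤ d) {α σ L c c₀ r₀ p q : ℝ} (Cα M : ℝ)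
    (hα : 0 ≤ α) (hσ : 0 ≤ σ) (hL : 0 ≤ L) (hc : 0 < c) (hc₀ : 0 < c₀) (hr₀ : 0 < r₀)
    (hp : 0 ≤ p) (hpq : p ≤ q) (hq : q = 1 - p * ((α + 1) / 2))
    (he : α < d - 1 → p + p * (d - 1 - α) / 2 ≤ q) :
    RegretBound d α Cα σ L c c₀ r₀ M p q := by
  intro κ₁ κ₂ hκ₁
  obtain ⟨D, hD, hgrowth⟩ := exists_gapIntegralBound_le hd Cα M hp hpq hα he
  have h2 : 0 < Real.log 2 := Real.log_pos one_lt_two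
  have hM : 0 < |M| + 1 := by positivity
  have hC : 0 ≤ max Cα 0 := le_max_right _ _
  have hV := unitBallVolume_pos d
  -- The first bound serves the packing argument; the second keeps all balls within the regularity
  -- radius `r₀`.
  set κ : ℝ := min (1 / (32 * (L + 1))) (r₀ / (|M| + 1)) with hκdef
  have hκ : 0 < κ := by positivity
  have hκL : 32 * (L + 1) * κ ≤ 1 := by
    calc 32 * (L + 1) * κ ≤ 32 * (L + 1) * (1 / (32 * (L + 1))) := by
          gcongr; exact min_le_left _ _
      _ = 1 := by field_simp
  have hκr : κ * (|M| + 1) ≤ r₀ := by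
    calc κ * (|M| + 1) ≤ r₀ / (|M| + 1) * (|M| + 1) := by gcongr; exact min_le_right _ _
      _ = r₀ := by field_simp
  set E := (α + 1) / 2 with hE
  set cE := (Real.log 2 ^ E)⁻¹ with hcE
  have hcE0 : 0 < cE := by positivity
  set C₁ := (2 : ℝ) ^ (d - 1) / (c * c₀ * unitBallVolume d * κ ^ d) with hC₁
  have hC₁0 : 0 ≤ C₁ := by positivity
  set K := 1 + 4 * Real.sqrt (2 * σ ^ 2 / κ₁) with hK
  have hK1 : 1 ≤ K := by
    have := Real.sqrt_nonneg (2 * σ ^ 2 / κ₁)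
    linarith
  set κ₃ := max κ₂ 0 with hκ₃
  have hκ₃0 : 0 ≤ κ₃ := le_max_right _ _
  refine ⟨2 * (|M| + 1) * cE + κ₃ * (|M| + 1) * cE + max Cα 0 * K ^ (α + 1) + C₁ * κ₃ * D,
    by positivity, ?_⟩
  intro 𝒜 _ _ _ _ _ Ω _ P _ 𝒳 f η X W A T k hT hk₁ hk₂ hprob hI hA
  refine ⟨hI.integrable_pathRegret hprob hL, ?_⟩
  have hT1 : (1 : ℝ) ≤ T := by exact_mod_cast hT
  have hT0 : (0 : ℝ) < T := by linarith
  have hlog0 : 0 ≤ Real.log (logArg d T (Fintype.card 𝒜)) :=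
    Real.log_nonneg (one_le_logArg hd hT Fintype.card_pos)
  -- With a single arm the logarithm can vanish (`d = T = 1`), but so does the regret; with two arms
  -- it is at least `log 2`.
  rcases Nat.lt_or_ge (Fintype.card 𝒜) 2 with hcard | hcard
  · have h1 : Fintype.card 𝒜 = 1 := by have := Fintype.card_pos (α := 𝒜); omega
    rw [pathRegret_eq_zero h1]
    simp only [Pi.zero_apply, integral_zero]
    positivity
  obtain ⟨hl2, hlT⟩ := log_logArg_ge hd hT hcard
  have hub := four_mul_bonus_le (d := d) (m := Fintype.card 𝒜) (σ := σ) hκ₁ hT hk₁ hlog0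
  set l := Real.log (logArg d T (Fintype.card 𝒜)) with hl
  have hl0 : 0 < l := h2.trans_le hl2
  set u := K * (l ^ ((1 : ℝ) / 2) * (T : ℝ) ^ (-(p / 2))) with hu
  have hu0 : 0 < u := by positivity
  have hk : 1 ≤ k := by
    have : (0 : ℝ) < k := lt_of_lt_of_le (by positivity) hk₁
    exact_mod_cast this
  -- The cut-off is `u / 2` freed of its logarithm: `K ≥ 1`, and `l ≥ log 2 > 1/4` gives `l^(1/2) ≥
  -- 1/2`.
  have hε : (T : ℝ) ^ (-(p / 2)) / 4 ≤ u / 2 := by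
    have hhalf : 1 / 2 ≤ l ^ ((1 : ℝ) / 2) := by
      rw [← Real.sqrt_eq_rpow]
      apply Real.le_sqrt_of_sq_le
      have := Real.log_two_gt_d9
      norm_num at this ⊢
      linarith
    calc (T : ℝ) ^ (-(p / 2)) / 4 = 1 * (1 / 2 * (T : ℝ) ^ (-(p / 2))) / 2 := by ring
      _ ≤ u / 2 := by rw [hu]; gcongr
  have hbound := hI.lintegral_pathRegret_le hprob hA hσ hd hL hc hc₀ hκ hκL hκr hu0 hk hT hub
    (by positivity) hε
  set G := gapIntegralBound d α Cα M ((T : ℝ) ^ (-(p / 2)) / 4) with hG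
  have hG0 : 0 ≤ G := gapIntegralBound_nonneg _ _ _ _ _
  have hm1 : (1 : ℝ) ≤ Fintype.card 𝒜 := by exact_mod_cast (by omega : 1 ≤ Fintype.card 𝒜)
  generalize hm : (Fintype.card 𝒜 : ℝ) = m at hm1 hbound ⊢
  have hkT : (k : ℝ) ≤ κ₃ * (T : ℝ) ^ p := hk₂.trans (by gcongr; exact le_max_left _ _)
  have hone : 1 ≤ cE * l ^ E := one_le_log_rpow (by positivity) hl2
  have hTq : 1 ≤ (T : ℝ) ^ q := Real.one_le_rpow hT1 (hp.trans hpq)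
  have hTpq : (T : ℝ) ^ p ≤ (T : ℝ) ^ q := Real.rpow_le_rpow_of_exponent_le hT1 hpq
  have t1 : 2 * (|M| + 1) ≤ 2 * (|M| + 1) * cE * (T : ℝ) ^ q * m * l ^ E := by
    calc 2 * (|M| + 1) = 2 * (|M| + 1) * (1 * 1 * 1) := by ring
      _ ≤ 2 * (|M| + 1) * (cE * l ^ E * (T : ℝ) ^ q * m) := by gcongr
      _ = _ := by ring
  have t2 : m * (k * (|M| + 1)) ≤ κ₃ * (|M| + 1) * cE * (T : ℝ) ^ q * m * l ^ E := by
    calc m * (k * (|M| + 1)) ≤ m * (κ₃ * (T : ℝ) ^ q * (|M| + 1)) * 1 := by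
          rw [mul_one]
          gcongr
          exact hkT.trans (by gcongr)
      _ ≤ m * (κ₃ * (T : ℝ) ^ q * (|M| + 1)) * (cE * l ^ E) := by gcongr
      _ = _ := by ring
  have t3 : T * (m * (u * (max Cα 0 * u ^ α))) =
      max Cα 0 * K ^ (α + 1) * (T : ℝ) ^ q * m * l ^ E := by
    have hua : u ^ (α + 1) = K ^ (α + 1) * (l ^ E * (T : ℝ) ^ (-(p * E))) := by
      rw [hu, Real.mul_rpow (by positivity) (by positivity),
        Real.mul_rpow (by positivity) (by positivity), ← Real.rpow_mul hl0.le,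
        ← Real.rpow_mul hT0.le, hE]
      congr 3 <;> ring
    calc T * (m * (u * (max Cα 0 * u ^ α))) = T * m * max Cα 0 * u ^ (α + 1) := by
          rw [Real.rpow_add_one hu0.ne']; ring
      _ = max Cα 0 * K ^ (α + 1) * ((T : ℝ) ^ (1 : ℝ) * (T : ℝ) ^ (-(p * E))) * m * l ^ E := by
          rw [hua, Real.rpow_one]; ring
      _ = _ := by rw [← Real.rpow_add hT0, hq, sub_eq_add_neg]
  have t4 : m * (k * C₁ * G) ≤ C₁ * κ₃ * D * (T : ℝ) ^ q * m * l ^ E := by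
    calc m * (k * C₁ * G) ≤ m * (κ₃ * (T : ℝ) ^ p * C₁ * G) := by gcongr
      _ = m * (κ₃ * C₁) * ((T : ℝ) ^ p * G) := by ring
      _ ≤ m * (κ₃ * C₁) * (D * (T : ℝ) ^ q * l ^ E) := by
          exact mul_le_mul_of_nonneg_left (hgrowth T l hT1 hl2 hlT) (by positivity)
      _ = _ := by ring
  rw [integral_eq_lintegral_of_nonneg_ae (Filter.Eventually.of_forall pathRegret_nonneg)
    (hI.integrable_pathRegret hprob hL).aestronglyMeasurable]
  refine ENNReal.toReal_le_of_le_ofReal (by positivity)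
    (hbound.trans (ENNReal.ofReal_le_ofReal ?_))
  linarith


end KNNBandit

theorem theorem3 (d : ℕ) (hd : 1 ≤ d) (α Cα σ L c c₀ r₀ M : ℝ)
    (hα : 0 ≤ α) (hαd : α ≤ d) (hσ : 0 ≤ σ) (hL : 0 ≤ L) (hc : 0 < c)
    (hc₀ : 0 < c₀) (hr₀ : 0 < r₀) :
    (α + 1 < d →
      KNNBandit.RegretBound d α Cα σ L c c₀ r₀ M (2 / ((d : ℝ) + 2)) (1 - (α + 1) / ((d : ℝ) + 2))) ∧
    ((d : ℝ) ≤ α + 1 →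
      KNNBandit.RegretBound d α Cα σ L c c₀ r₀ M (2 / (α + 3)) (2 / (α + 3))) := by
  have hd0 : (0 : ℝ) ≤ d := Nat.cast_nonneg d
  refine ⟨fun h => ?_, fun h => ?_⟩
  · have hne : (0 : ℝ) < (d : ℝ) + 2 := by linarith
    refine KNNBandit.regretBound_of_exponents hd Cα M hα hσ hL hc hc₀ hr₀ (by positivity) ?_ ?_
      -- For `d > α + 1` the large and small gaps balance exactly.
      fun _ => le_of_eq ?_
    · rw [le_sub_iff_add_le, ← add_div, div_le_one hne]
      linarith
    · field_simp
    · field_simp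
      ring
  · have hne : (0 : ℝ) < α + 3 := by linarith
    refine KNNBandit.regretBound_of_exponents hd Cα M hα hσ hL hc hc₀ hr₀ (by positivity) le_rfl ?_
      fun h' => absurd h' (by linarith)
    field_simp
    ring
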